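/- **Syntax.** Fix term variables $x_0,x_1,\dots$, constructor variables $\alpha_0,\alpha_1,\dots$ and oracle constants $o_0,o_1,\dots$. Terms, type constructors and kinds, taken up to renaming of bound variables, are given by $$t,s ::= x \mid o \mid \lambda x{:}\varphi.t \mid ts \mid t\oplus_p s \mid t\nu \mid \langle t,s\rangle \mid t\pi_0 \mid t\pi_1 \mid \mathrm{efq}(t) \mid [\kappa]^p \mid [t,[\kappa_1/\dots/\kappa_n],s]^p,$$ $$\varphi ::= \alpha \mid \bot \mid \lambda x{:}\varphi_1.\varphi_2 \mid \varphi t \mid \forall x{:}\varphi_1.\varphi_2 \mid \oplus\varphi \mid \Sigma\varphi \mid \varphi_1\wedge\varphi_2,\qquad \Phi ::= * \mid \Pi x{:}\varphi.\Phi,$$ where $p\in\mathbb Q\cap[0,1]$ (the exponent $p$ is optional) and the $\kappa$'s are finite lists of terms. $\langle t_1,\dots,t_n\rangle$ denotes right-nested pairs and $A_1\wedge\dots\wedge A_n$ right-nested conjunctions ($n\ge 1$). The subterms of $\lambda x{:}\varphi.t$ are itself and the subterms of $t$ (an annotation has no subterms); the subterms of any other term are itself and those of the terms it is built from. The subconstructors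 of $\lambda x{:}\varphi_1.\varphi_2$ and of $\forall x{:}\varphi_1.\varphi_2$ are the constructor itself and those of $\varphi_2$, those of $\varphi t$ are itself and those of $\varphi$, and those of $\oplus\varphi$, $\Sigma\varphi$, $\varphi_1\wedge\varphi_2$ are itself and those of the components. **Reduction of type constructors.** $X\mapsto X'$ holds if $X'$ results from $X$ by contracting one redex $(\lambda x{:}\varphi_1.\varphi_2)t$ to $\varphi_2[t/x]$ anywhere inside the type constructor, term or kind $X$. Let $\mapsto^*$ be the reflexive transitive closure, and let $X\equiv_\beta X'$ mean that $X\mapsto^*X'$ or $X'\mapsto^*X$. **Typing.** Each oracle constant $o$ has arity $0$ and an associated type $\Sigma A$, or arity $1$ and an associated type $\forall x{:}A.\Sigma B$. A context $\Gamma$ is a list of assignments $x:A$ and $\alpha:\Phi$. Sequents $\Gamma\vdash\Phi:\square$, $\Gamma\vdash\varphi:\Phi$, $\Gamma\vdash t:A$ are derived by the following rules ($J$ is any right-hand side; "new" means not assigned and not free in $\Gamma$; $i\in\{0,1\}$; $n\ge1$). * Axioms: $\vdash *:\square$; $\vdash\bot:*$; $\Gamma,\alpha:\Phi\vdash\alpha:\Phi$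 from $\Gamma\vdash\Phi:\square$, $\alpha$ new; $\Gamma,x:A\vdash x:A$ from $\Gamma\vdash A:*$, $x$ new. * Formation: $\Gamma\vdash(\Pi x{:}A.\Phi):\square$ from $\Gamma,x:A\vdash\Phi:\square$; $\Gamma\vdash(\forall x{:}A.B):*$ from $\Gamma,x:A\vdash B:*$; $\Gamma\vdash\oplus A:*$ and $\Gamma\vdash\Sigma A:*$ from $\Gamma\vdash A:*$; $\Gamma\vdash A\wedge B:*$ from $\Gamma\vdash A:*$ and $\Gamma\vdash B:*$. * Kinding: $\Gamma\vdash(\lambda x{:}A.\varphi):(\Pi x{:}A.\Phi)$ from $\Gamma,x:A\vdash\varphi:\Phi$; $\Gamma\vdash\varphi t:\Phi[t/x]$ from $\Gamma\vdash\varphi:(\Pi x{:}A.\Phi)$ and $\Gamma\vdash t:A$. * Weakening: $\Gamma,\alpha:\Psi\vdash J$ from $\Gamma\vdash\Psi:\square$ and $\Gamma\vdash J$, $\alpha$ new; $\Gamma,x:A\vdash J$ from $\Gamma\vdash A:*$ and $\Gamma\vdash J$, $x$ new. * Typing: $\Gamma\vdash\lambda x{:}A.t:\forall x{:}A.B$ from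 $\Gamma,x:A\vdash t:B$; $\Gamma\vdash ts:B[s/x]$ from $\Gamma\vdash t:\forall x{:}A.B$ and $\Gamma\vdash s:A$; $\Gamma\vdash\mathrm{efq}(t):P$ from $\Gamma\vdash t:\bot$ and $\Gamma\vdash P:*$, if no subconstructor of $P$ is a $\forall$; $\Gamma\vdash\langle s,t\rangle:A\wedge B$ from $\Gamma\vdash s:A$ and $\Gamma\vdash t:B$; $\Gamma\vdash t\pi_i:A_i$ from $\Gamma\vdash t:A_0\wedge A_1$; $\Gamma\vdash t\oplus_p s:\oplus A$ from $\Gamma\vdash t:A$ and $\Gamma\vdash s:A$; $\Gamma\vdash t\nu:A$ from $\Gamma\vdash t:\oplus A$. * Oracles: $\Gamma\vdash o:\Sigma A$ from $\Gamma\vdash A:*$, if $\Sigma A$ is the type of the $0$-ary $o$; $\Gamma\vdash o:\forall x{:}A.\Sigma B$ from $\Gamma\vdash(\forall x{:}A.\Sigma B):*$, if this is the type of the $1$-ary $o$; $\Gamma\vdash o\nu:A$ from $\Gamma\vdash o:\Sigma A$; $\Gamma\vdash ot:\Sigma(B[t/x])$ from $\Gamma\vdash o:\forall x{:}A.\Sigma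 B$ and $\Gamma\vdash t:A$; $\Gamma\vdash\langle o\nu,\dots,o\nu\rangle:A\wedge\dots\wedge A$ ($n$ times) from $\Gamma\vdash o\nu:A$, $o$ being $0$-ary; $\Gamma\vdash\langle(ot_1)\nu,\dots,(ot_n)\nu\rangle:B[t_1/x]\wedge\dots\wedge B[t_n/x]$ from $\Gamma\vdash o:\forall x{:}A.\Sigma B$ and $\Gamma\vdash t_i:A$ for all $i$. * Conversion: $\Gamma\vdash\varphi:\Psi$ from $\Gamma\vdash\varphi:\Phi$, $\Gamma\vdash\Psi:\square$, $\Phi\equiv_\beta\Psi$; $\Gamma\vdash s:D$ from $\Gamma\vdash t:C$, $\Gamma\vdash D:*$, $C\equiv_\beta D$, $t\equiv_\beta s$. We write $t:A$ (resp. $\varphi:\Phi$) if $\Gamma\vdash t:A$ (resp. $\Gamma\vdash\varphi:\Phi$) is derivable for some $\Gamma$. **Oracular functions.** A term context $\mathcal C[\;]_1\dots[\;]_n$ is a term with $n$ distinct designated free variables (holes), each occurring exactly once. Each oracle constant $o$ comes with a function $f_o$ assigning to each term context with $n$ holes and each $1\le m\le n$ a closed term without oracle constants (closed: without free term variables). If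 $o$ has type $\Sigma A$, this term has type $A$. If $o$ has type $\forall x{:}A.\Sigma B$, it has type $B[t/x]$, where $t$ is the term to which the $m$-th hole is applied; when there is no such $t$, or $t$ contains variables bound by the context, or no closed term without oracle constants has type $B[t/x]$, it is only required to have type $B[t'/x]$ for some term $t'$. **Evaluation.** The relation $t\mapsto_p t'$ is generated by $$(\lambda x{:}A.t)s\mapsto_1 t[s/x],\quad \langle t_0,t_1\rangle\pi_i\mapsto_1 t_i,\quad (t\oplus_p s)\nu\mapsto_p t,\quad (t\oplus_p s)\nu\mapsto_{1-p}s,$$ by $\mathcal C[o\nu]_1\dots[o\nu]_n\mapsto_1\mathcal C[s_1]_1\dots[s_n]_n$ for $0$-ary $o$, $n\ge1$ and $s_i=f_o(\mathcal C[\;]_1\dots[\;]_n,i)$, by $\mathcal C[(ot_1)\nu]_1\dots[(ot_n)\nu]_n=\mathcal D[o]_1\dots[o]_n\mapsto_1\mathcal C[s_1]_1\dots[s_n]_n$ for $1$-ary $o$, $n\ge1$, $\mathcal D[\;]_1\dots[\;]_n=\mathcal C[([\;]_1t_1)\nu]_1\dots[([\;]_nt_n)\nu]_n$ and $s_i=f_o(\mathcal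 D[\;]_1\dots[\;]_n,i)$ (the $t_i$ may contain variables bound by $\mathcal C$), and by closure at any depth inside a term: if $t\mapsto_p t'$, then $s[t/x]\mapsto_p s[t'/x]$ for each term $s$ that has the free variable $x$ as a subterm, and $\lambda x{:}A.t\mapsto_p\lambda x{:}A.t'$. **Theorem (Strong normalisation).** For all such assignments of types and oracular functions to the oracle constants: 1. if $t:A$, there is no infinite sequence $t\mapsto_{p_1}t_1\mapsto_{p_2}t_2\mapsto_{p_3}\cdots$; 2. if $\varphi:\Phi$, there is no infinite sequence $\varphi\mapsto\varphi_1\mapsto\varphi_2\mapsto\cdots$ of type constructors. -/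

import Mathlib

namespace OracleCalculus

/-! ## Syntax -/

/-- The syntactic categories: terms, type constructors, kinds, lists `κ` of terms, and lists
`κ₁ / ⋯ / κₙ` of lists of terms. -/
inductive Srt : Type
  | tm | con | kind | tms | tmss

/-- Rational probabilities. -/
abbrev Prob : Type := Set.Icc (0 : ℚ) 1

/-- Expressions modulo renaming of bound variables. `Expr s n` is the type of expressions of
category `s` in the scope of `n` binders: bound variables are de Bruijn indices `bvar i`, `i < n`
(index `0` is the innermost binder), while free term variables `x₀, x₁, …`, constructor variables
`α₀, α₁, …` (which are never bound) and oracle constants `o₀, o₁, …` are named by natural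
numbers. The terms, type constructors and kinds of the calculus are those with `n = 0`. -/
inductive Expr : Srt → ℕ → Type
  -- terms
  | bvar {n : ℕ} (i : Fin n) : Expr .tm n
  | fvar {n : ℕ} (x : ℕ) : Expr .tm n
  | orc {n : ℕ} (o : ℕ) : Expr .tm n
  /-- `λ x : φ. t` -/
  | lam {n : ℕ} (A : Expr .con n) (t : Expr .tm (n + 1)) : Expr .tm n
  | app {n : ℕ} (t s : Expr .tm n) : Expr .tm n
  /-- the probabilistic choice `t ⊕ₚ s` -/
  | choice {n : ℕ} (p : Prob) (t s : Expr .tm n) : Expr .tm n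
  /-- `t ν` -/
  | nu {n : ℕ} (t : Expr .tm n) : Expr .tm n
  | pair {n : ℕ} (t s : Expr .tm n) : Expr .tm n
  /-- `t π_j` -/
  | proj {n : ℕ} (j : Fin 2) (t : Expr .tm n) : Expr .tm n
  /-- `efq(t)` -/
  | efq {n : ℕ} (t : Expr .tm n) : Expr .tm n
  /-- `[κ]` or `[κ]^p` -/
  | comp {n : ℕ} (p : Option Prob) (k : Expr .tms n) : Expr .tm n
  /-- `[t, [κ₁/⋯/κₙ], s]` or `[t, [κ₁/⋯/κₙ], s]^p` -/
  | comps {n : ℕ} (p : Option Prob) (t : Expr .tm n) (K : Expr .tmss n) (s : Expr .tm n) :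
      Expr .tm n
  -- type constructors
  | cvar {n : ℕ} (α : ℕ) : Expr .con n
  /-- `⊥` -/
  | bot {n : ℕ} : Expr .con n
  /-- `λ x : φ₁. φ₂` -/
  | clam {n : ℕ} (A : Expr .con n) (φ : Expr .con (n + 1)) : Expr .con n
  /-- `φ t` -/
  | capp {n : ℕ} (φ : Expr .con n) (t : Expr .tm n) : Expr .con n
  /-- `∀ x : φ₁. φ₂` -/
  | all {n : ℕ} (A : Expr .con n) (φ : Expr .con (n + 1)) : Expr .con n
  /-- `⊕ φ` -/
  | plus {n : ℕ} (φ : Expr .con n) : Expr .con n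
  /-- `Σ φ` -/
  | sig {n : ℕ} (φ : Expr .con n) : Expr .con n
  /-- `φ₁ ∧ φ₂` -/
  | conj {n : ℕ} (φ ψ : Expr .con n) : Expr .con n
  -- kinds
  /-- `*` -/
  | star {n : ℕ} : Expr .kind n
  /-- `Π x : φ. Φ` -/
  | pi {n : ℕ} (A : Expr .con n) (Φ : Expr .kind (n + 1)) : Expr .kind n
  -- lists of terms and lists of lists of terms
  | nil {n : ℕ} : Expr .tms n
  | cons {n : ℕ} (t : Expr .tm n) (k : Expr .tms n) : Expr .tms n
  | nils {n : ℕ} : Expr .tmss n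
  | conss {n : ℕ} (k : Expr .tms n) (K : Expr .tmss n) : Expr .tmss n

abbrev Tm : Type := Expr .tm 0
abbrev Con : Type := Expr .con 0
abbrev Kind : Type := Expr .kind 0

/-- Extension of a map of de Bruijn indices under a binder. -/
def liftRen {n m : ℕ} (r : Fin n → Fin m) : Fin (n + 1) → Fin (m + 1) :=
  Fin.cases 0 (fun i => (r i).succ)

namespace Expr

/-- Renaming of de Bruijn indices. -/
def rename {s : Srt} {n m : ℕ} (r : Fin n → Fin m) : Expr s n → Expr s m
  | bvar i => bvar (r i)
  | fvar x => fvar x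
  | orc o => orc o
  | lam A t => lam (A.rename r) (t.rename (liftRen r))
  | app t s => app (t.rename r) (s.rename r)
  | choice p t s => choice p (t.rename r) (s.rename r)
  | nu t => nu (t.rename r)
  | pair t s => pair (t.rename r) (s.rename r)
  | proj j t => proj j (t.rename r)
  | efq t => efq (t.rename r)
  | comp p k => comp p (k.rename r)
  | comps p t K s => comps p (t.rename r) (K.rename r) (s.rename r)
  | cvar α => cvar α
  | bot => bot
  | clam A φ => clam (A.rename r) (φ.rename (liftRen r))
  | capp φ t => capp (φ.rename r) (t.rename r)
  | all A φ => all (A.rename r) (φ.rename (liftRen r))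
  | plus φ => plus (φ.rename r)
  | sig φ => sig (φ.rename r)
  | conj φ ψ => conj (φ.rename r) (ψ.rename r)
  | star => star
  | pi A Φ => pi (A.rename r) (Φ.rename (liftRen r))
  | nil => nil
  | cons t k => cons (t.rename r) (k.rename r)
  | nils => nils
  | conss k K => conss (k.rename r) (K.rename r)

end Expr

/-- Extension, under a binder, of an assignment of terms to de Bruijn indices. -/
def liftB {n m : ℕ} (b : Fin n → Expr .tm m) : Fin (n + 1) → Expr .tm (m + 1) :=
  Fin.cases (.bvar 0) (fun i => (b i).rename Fin.succ)

/-- Extension, under a binder, of an assignment of terms to free term variables. -/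
def liftF {m : ℕ} (f : ℕ → Expr .tm m) : ℕ → Expr .tm (m + 1) :=
  fun x => (f x).rename Fin.succ

namespace Expr

/-- Simultaneous capture-avoiding substitution of the terms `b i` for the de Bruijn indices `i`
and of the terms `f x` for the free term variables `x`. -/
def subst {s : Srt} {n m : ℕ} (b : Fin n → Expr .tm m) (f : ℕ → Expr .tm m) :
    Expr s n → Expr s m
  | bvar i => b i
  | fvar x => f x
  | orc o => orc o
  | lam A t => lam (A.subst b f) (t.subst (liftB b) (liftF f))
  | app t s => app (t.subst b f) (s.subst b f)
  | choice p t s => choice p (t.subst b f) (s.subst b f)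
  | nu t => nu (t.subst b f)
  | pair t s => pair (t.subst b f) (s.subst b f)
  | proj j t => proj j (t.subst b f)
  | efq t => efq (t.subst b f)
  | comp p k => comp p (k.subst b f)
  | comps p t K s => comps p (t.subst b f) (K.subst b f) (s.subst b f)
  | cvar α => cvar α
  | bot => bot
  | clam A φ => clam (A.subst b f) (φ.subst (liftB b) (liftF f))
  | capp φ t => capp (φ.subst b f) (t.subst b f)
  | all A φ => all (A.subst b f) (φ.subst (liftB b) (liftF f))
  | plus φ => plus (φ.subst b f)
  | sig φ => sig (φ.subst b f)
  | conj φ ψ => conj (φ.subst b f) (ψ.subst b f)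
  | star => star
  | pi A Φ => pi (A.subst b f) (Φ.subst (liftB b) (liftF f))
  | nil => nil
  | cons t k => cons (t.subst b f) (k.subst b f)
  | nils => nils
  | conss k K => conss (k.subst b f) (K.subst b f)

/-- Instantiation of the innermost bound variable: if `e` is the body of a binder for `x`, then
`e.inst u` is `e[u/x]`. -/
def inst {s : Srt} {n : ℕ} (e : Expr s (n + 1)) (u : Expr .tm n) : Expr s n :=
  e.subst (Fin.cases u bvar) fvar

/-- Binding the free term variable `x`: the expressions `λ x : A. t`, `λ x : A. φ`, `∀ x : A. φ`
and `Π x : A. Φ` are `lam A (t.close x)`, `clam A (φ.close x)`, `all A (φ.close x)` and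
`pi A (Φ.close x)`. -/
def close {s : Srt} {n : ℕ} (e : Expr s n) (x : ℕ) : Expr s (n + 1) :=
  e.subst (fun i => bvar i.succ) (fun y => if y = x then bvar 0 else fvar y)

/-- Simultaneous substitution for free term variables. -/
def fsubst {s : Srt} (e : Expr s 0) (f : ℕ → Tm) : Expr s 0 :=
  e.subst bvar f

/-- `e[u/x]` for a free term variable `x`. -/
def subst1 {s : Srt} (e : Expr s 0) (u : Tm) (x : ℕ) : Expr s 0 :=
  e.fsubst (Function.update fvar x u)

end Expr

/-- Free term variables, constructor variables and oracle constants. -/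
inductive Atom : Type
  | tv (x : ℕ) | cv (α : ℕ) | oc (o : ℕ)
  deriving DecidableEq

namespace Expr

/-- The number of occurrences of an atom anywhere in an expression, type annotations included
(occurrences of bound variables are not occurrences of a free variable). -/
def count {s : Srt} {n : ℕ} (a : Atom) : Expr s n → ℕ
  | bvar _ => 0
  | fvar x => if a = .tv x then 1 else 0
  | orc o => if a = .oc o then 1 else 0
  | lam A t => A.count a + t.count a
  | app t s => t.count a + s.count a
  | choice _ t s => t.count a + s.count a
  | nu t => t.count a
  | pair t s => t.count a + s.count a
  | proj _ t => t.count a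
  | efq t => t.count a
  | comp _ k => k.count a
  | comps _ t K s => t.count a + K.count a + s.count a
  | cvar α => if a = .cv α then 1 else 0
  | bot => 0
  | clam A φ => A.count a + φ.count a
  | capp φ t => φ.count a + t.count a
  | all A φ => A.count a + φ.count a
  | plus φ => φ.count a
  | sig φ => φ.count a
  | conj φ ψ => φ.count a + ψ.count a
  | star => 0
  | pi A Φ => A.count a + Φ.count a
  | nil => 0
  | cons t k => t.count a + k.count a
  | nils => 0
  | conss k K => k.count a + K.count a

/-- The free variable `x` is a subterm of the given term (or list of terms). The subterms of
`λ x : φ. t` are itself and the subterms of `t`: the annotation `φ` has no subterms. -/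
def HasSubtermVar {s : Srt} {n : ℕ} (x : ℕ) : Expr s n → Prop
  | bvar _ => False
  | fvar y => y = x
  | orc _ => False
  | lam _ t => t.HasSubtermVar x
  | app t s => t.HasSubtermVar x ∨ s.HasSubtermVar x
  | choice _ t s => t.HasSubtermVar x ∨ s.HasSubtermVar x
  | nu t => t.HasSubtermVar x
  | pair t s => t.HasSubtermVar x ∨ s.HasSubtermVar x
  | proj _ t => t.HasSubtermVar x
  | efq t => t.HasSubtermVar x
  | comp _ k => k.HasSubtermVar x
  | comps _ t K s => t.HasSubtermVar x ∨ K.HasSubtermVar x ∨ s.HasSubtermVar x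
  | nil => False
  | cons t k => t.HasSubtermVar x ∨ k.HasSubtermVar x
  | nils => False
  | conss k K => k.HasSubtermVar x ∨ K.HasSubtermVar x
  | cvar _ => False
  | bot => False
  | clam _ _ => False
  | capp _ _ => False
  | all _ _ => False
  | plus _ => False
  | sig _ => False
  | conj _ _ => False
  | star => False
  | pi _ _ => False

/-- No subconstructor of the given type constructor is of the form `∀ x : φ₁. φ₂`. -/
def ForallFree {s : Srt} {n : ℕ} : Expr s n → Prop
  | all _ _ => False
  | clam _ φ => φ.ForallFree
  | capp φ _ => φ.ForallFree
  | plus φ => φ.ForallFree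
  | sig φ => φ.ForallFree
  | conj φ ψ => φ.ForallFree ∧ ψ.ForallFree
  | _ => True

/-- No free term variables. -/
def Closed {s : Srt} {n : ℕ} (e : Expr s n) : Prop := ∀ x, e.count (.tv x) = 0

/-- No oracle constants. -/
def OracleFree {s : Srt} {n : ℕ} (e : Expr s n) : Prop := ∀ o, e.count (.oc o) = 0

end Expr

open _root_.OracleCalculus.Expr

/-! ## β-reduction of type constructors and conversion -/

/-- `X ↦ X'`: contraction of one redex `(λ x : φ₁. φ₂) t` to `φ₂[t/x]` anywhere inside a type
constructor, a term or a kind. -/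
inductive ConStep : {s : Srt} → {n : ℕ} → Expr s n → Expr s n → Prop
  | beta {n : ℕ} (A : Expr .con n) (φ : Expr .con (n + 1)) (t : Expr .tm n) :
      ConStep (capp (clam A φ) t) (φ.inst t)
  | lam₁ {n : ℕ} {A A' : Expr .con n} {t : Expr .tm (n + 1)} :
      ConStep A A' → ConStep (lam A t) (lam A' t)
  | lam₂ {n : ℕ} {A : Expr .con n} {t t' : Expr .tm (n + 1)} :
      ConStep t t' → ConStep (lam A t) (lam A t')
  | app₁ {n : ℕ} {t t' s : Expr .tm n} : ConStep t t' → ConStep (app t s) (app t' s)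
  | app₂ {n : ℕ} {t s s' : Expr .tm n} : ConStep s s' → ConStep (app t s) (app t s')
  | choice₁ {n : ℕ} {p : Prob} {t t' s : Expr .tm n} :
      ConStep t t' → ConStep (choice p t s) (choice p t' s)
  | choice₂ {n : ℕ} {p : Prob} {t s s' : Expr .tm n} :
      ConStep s s' → ConStep (choice p t s) (choice p t s')
  | nu {n : ℕ} {t t' : Expr .tm n} : ConStep t t' → ConStep (nu t) (nu t')
  | pair₁ {n : ℕ} {t t' s : Expr .tm n} : ConStep t t' → ConStep (pair t s) (pair t' s)
  | pair₂ {n : ℕ} {t s s' : Expr .tm n} : ConStep s s' → ConStep (pair t s) (pair t s')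
  | proj {n : ℕ} {j : Fin 2} {t t' : Expr .tm n} : ConStep t t' → ConStep (proj j t) (proj j t')
  | efq {n : ℕ} {t t' : Expr .tm n} : ConStep t t' → ConStep (efq t) (efq t')
  | comp {n : ℕ} {p : Option Prob} {k k' : Expr .tms n} :
      ConStep k k' → ConStep (comp p k) (comp p k')
  | comps₁ {n : ℕ} {p : Option Prob} {t t' s : Expr .tm n} {K : Expr .tmss n} :
      ConStep t t' → ConStep (comps p t K s) (comps p t' K s)
  | comps₂ {n : ℕ} {p : Option Prob} {t s : Expr .tm n} {K K' : Expr .tmss n} :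
      ConStep K K' → ConStep (comps p t K s) (comps p t K' s)
  | comps₃ {n : ℕ} {p : Option Prob} {t s s' : Expr .tm n} {K : Expr .tmss n} :
      ConStep s s' → ConStep (comps p t K s) (comps p t K s')
  | clam₁ {n : ℕ} {A A' : Expr .con n} {φ : Expr .con (n + 1)} :
      ConStep A A' → ConStep (clam A φ) (clam A' φ)
  | clam₂ {n : ℕ} {A : Expr .con n} {φ φ' : Expr .con (n + 1)} :
      ConStep φ φ' → ConStep (clam A φ) (clam A φ')
  | capp₁ {n : ℕ} {φ φ' : Expr .con n} {t : Expr .tm n} :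
      ConStep φ φ' → ConStep (capp φ t) (capp φ' t)
  | capp₂ {n : ℕ} {φ : Expr .con n} {t t' : Expr .tm n} :
      ConStep t t' → ConStep (capp φ t) (capp φ t')
  | all₁ {n : ℕ} {A A' : Expr .con n} {φ : Expr .con (n + 1)} :
      ConStep A A' → ConStep (all A φ) (all A' φ)
  | all₂ {n : ℕ} {A : Expr .con n} {φ φ' : Expr .con (n + 1)} :
      ConStep φ φ' → ConStep (all A φ) (all A φ')
  | plus {n : ℕ} {φ φ' : Expr .con n} : ConStep φ φ' → ConStep (plus φ) (plus φ')
  | sig {n : ℕ} {φ φ' : Expr .con n} : ConStep φ φ' → ConStep (sig φ) (sig φ')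
  | conj₁ {n : ℕ} {φ φ' ψ : Expr .con n} : ConStep φ φ' → ConStep (conj φ ψ) (conj φ' ψ)
  | conj₂ {n : ℕ} {φ ψ ψ' : Expr .con n} : ConStep ψ ψ' → ConStep (conj φ ψ) (conj φ ψ')
  | pi₁ {n : ℕ} {A A' : Expr .con n} {Φ : Expr .kind (n + 1)} :
      ConStep A A' → ConStep (pi A Φ) (pi A' Φ)
  | pi₂ {n : ℕ} {A : Expr .con n} {Φ Φ' : Expr .kind (n + 1)} :
      ConStep Φ Φ' → ConStep (pi A Φ) (pi A Φ')
  | cons₁ {n : ℕ} {t t' : Expr .tm n} {k : Expr .tms n} :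
      ConStep t t' → ConStep (cons t k) (cons t' k)
  | cons₂ {n : ℕ} {t : Expr .tm n} {k k' : Expr .tms n} :
      ConStep k k' → ConStep (cons t k) (cons t k')
  | conss₁ {n : ℕ} {k k' : Expr .tms n} {K : Expr .tmss n} :
      ConStep k k' → ConStep (conss k K) (conss k' K)
  | conss₂ {n : ℕ} {k : Expr .tms n} {K K' : Expr .tmss n} :
      ConStep K K' → ConStep (conss k K) (conss k K')

/-- `X ≡ X'`: one of `X`, `X'` reduces to the other in finitely many (possibly zero) steps. -/
def Conv {s : Srt} {n : ℕ} (X X' : Expr s n) : Prop :=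
  Relation.ReflTransGen ConStep X X' ∨ Relation.ReflTransGen ConStep X' X

/-! ## Derivations -/

/-- The arity of an oracle constant together with its associated type: `Σ A` for a `0`-ary
constant, `∀ x : A. Σ B` (with `B` in the scope of `x`) for a `1`-ary one. -/
inductive OracleType : Type
  | nullary (A : Con)
  | unary (A : Con) (B : Expr .con 1)

/-- An assignment of arities and types to the oracle constants `o₀, o₁, …`. -/
abbrev OracleSig : Type := ℕ → OracleType

/-- An element `x : A` or `α : Φ` of a context. -/
inductive Decl : Type
  | tm (x : ℕ) (A : Con)
  | con (α : ℕ) (Φ : Kind)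

/-- The atom `a` is declared by `d` or occurs free in the type or kind assigned by `d`. -/
def Decl.Mentions (a : Atom) : Decl → Prop
  | .tm x A => a = .tv x ∨ 0 < A.count a
  | .con α Φ => a = .cv α ∨ 0 < Φ.count a

/-- Contexts `Γ`; the head of the list is the rightmost assignment. -/
abbrev Ctx : Type := List Decl

def Ctx.Fresh (a : Atom) (Γ : Ctx) : Prop := ∀ d ∈ Γ, ¬ d.Mentions a

/-- The right-hand sides `Φ : □`, `φ : Φ` and `t : A` of sequents. -/
inductive Judgement : Type
  | kind (Φ : Kind)
  | con (φ : Con) (Φ : Kind)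
  | tm (t : Tm) (A : Con)

/-- `⟨t₁, ⟨t₂, ⋯ ⟨tₙ₋₁, tₙ⟩ ⋯ ⟩⟩`, which is `t₁` for `n = 1`. -/
def tuple : Tm → List Tm → Tm
  | t, [] => t
  | t, s :: l => pair t (tuple s l)

/-- `A₁ ∧ (A₂ ∧ ⋯ (Aₙ₋₁ ∧ Aₙ) ⋯ )`, which is `A₁` for `n = 1`. -/
def bigConj : Con → List Con → Con
  | A, [] => A
  | A, B :: l => conj A (bigConj B l)

/-- `Γ ⊢ J` is derivable. -/
inductive Derives (S : OracleSig) : Ctx → Judgement → Prop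
  -- formation and axiom rules
  | cvar {Γ : Ctx} {α : ℕ} {Φ : Kind} : Γ.Fresh (.cv α) → Derives S Γ (.kind Φ) →
      Derives S (.con α Φ :: Γ) (.con (cvar α) Φ)
  | fvar {Γ : Ctx} {x : ℕ} {A : Con} : Γ.Fresh (.tv x) → Derives S Γ (.con A star) →
      Derives S (.tm x A :: Γ) (.tm (fvar x) A)
  | star : Derives S [] (.kind star)
  | bot : Derives S [] (.con bot star)
  | pi {Γ : Ctx} {x : ℕ} {A : Con} {Φ : Kind} : Derives S (.tm x A :: Γ) (.kind Φ) →
      Derives S Γ (.kind (pi A (Φ.close x)))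
  | all {Γ : Ctx} {x : ℕ} {A B : Con} : Derives S (.tm x A :: Γ) (.con B star) →
      Derives S Γ (.con (all A (B.close x)) star)
  | plus {Γ : Ctx} {A : Con} : Derives S Γ (.con A star) → Derives S Γ (.con (plus A) star)
  | sig {Γ : Ctx} {A : Con} : Derives S Γ (.con A star) → Derives S Γ (.con (sig A) star)
  | conj {Γ : Ctx} {A B : Con} : Derives S Γ (.con A star) → Derives S Γ (.con B star) →
      Derives S Γ (.con (conj A B) star)
  -- kind assignment rules
  | clam {Γ : Ctx} {x : ℕ} {A φ : Con} {Φ : Kind} : Derives S (.tm x A :: Γ) (.con φ Φ) →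
      Derives S Γ (.con (clam A (φ.close x)) (pi A (Φ.close x)))
  | capp {Γ : Ctx} {A φ : Con} {Φ : Expr .kind 1} {t : Tm} :
      Derives S Γ (.con φ (pi A Φ)) → Derives S Γ (.tm t A) →
      Derives S Γ (.con (capp φ t) (Φ.inst t))
  -- weakening rules
  | weakenCon {Γ : Ctx} {α : ℕ} {Ψ : Kind} {J : Judgement} : Γ.Fresh (.cv α) →
      Derives S Γ (.kind Ψ) → Derives S Γ J → Derives S (.con α Ψ :: Γ) J
  | weakenTm {Γ : Ctx} {x : ℕ} {A : Con} {J : Judgement} : Γ.Fresh (.tv x) →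
      Derives S Γ (.con A star) → Derives S Γ J → Derives S (.tm x A :: Γ) J
  -- type assignment rules
  | lam {Γ : Ctx} {x : ℕ} {A B : Con} {t : Tm} : Derives S (.tm x A :: Γ) (.tm t B) →
      Derives S Γ (.tm (lam A (t.close x)) (all A (B.close x)))
  | app {Γ : Ctx} {A : Con} {B : Expr .con 1} {t s : Tm} :
      Derives S Γ (.tm t (all A B)) → Derives S Γ (.tm s A) →
      Derives S Γ (.tm (app t s) (B.inst s))
  | efq {Γ : Ctx} {P : Con} {t : Tm} : P.ForallFree →
      Derives S Γ (.tm t bot) → Derives S Γ (.con P star) → Derives S Γ (.tm (efq t) P)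
  | pair {Γ : Ctx} {A B : Con} {s t : Tm} : Derives S Γ (.tm s A) → Derives S Γ (.tm t B) →
      Derives S Γ (.tm (pair s t) (conj A B))
  | proj₀ {Γ : Ctx} {A B : Con} {t : Tm} : Derives S Γ (.tm t (conj A B)) →
      Derives S Γ (.tm (proj 0 t) A)
  | proj₁ {Γ : Ctx} {A B : Con} {t : Tm} : Derives S Γ (.tm t (conj A B)) →
      Derives S Γ (.tm (proj 1 t) B)
  | choice {Γ : Ctx} {A : Con} {p : Prob} {t s : Tm} :
      Derives S Γ (.tm t A) → Derives S Γ (.tm s A) → Derives S Γ (.tm (choice p t s) (plus A))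
  | nu {Γ : Ctx} {A : Con} {t : Tm} : Derives S Γ (.tm t (plus A)) → Derives S Γ (.tm (nu t) A)
  | orc₀ {Γ : Ctx} {o : ℕ} {A : Con} : S o = .nullary A → Derives S Γ (.con A star) →
      Derives S Γ (.tm (orc o) (sig A))
  | orc₁ {Γ : Ctx} {o : ℕ} {A : Con} {B : Expr .con 1} : S o = .unary A B →
      Derives S Γ (.con (all A (sig B)) star) → Derives S Γ (.tm (orc o) (all A (sig B)))
  | orcNu {Γ : Ctx} {o : ℕ} {A : Con} : Derives S Γ (.tm (orc o) (sig A)) →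
      Derives S Γ (.tm (nu (orc o)) A)
  | orcApp {Γ : Ctx} {o : ℕ} {A : Con} {B : Expr .con 1} {t : Tm} :
      Derives S Γ (.tm (orc o) (all A (sig B))) → Derives S Γ (.tm t A) →
      Derives S Γ (.tm (app (orc o) t) (sig (B.inst t)))
  | orcTuple₀ {Γ : Ctx} {o : ℕ} {A A' : Con} (k : ℕ) : S o = .nullary A' →
      Derives S Γ (.tm (nu (orc o)) A) →
      Derives S Γ (.tm (tuple (nu (orc o)) (List.replicate k (nu (orc o))))
        (bigConj A (List.replicate k A)))
  | orcTuple₁ {Γ : Ctx} {o : ℕ} {A : Con} {B : Expr .con 1} {t : Tm} {l : List Tm} :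
      Derives S Γ (.tm (orc o) (all A (sig B))) → (∀ u ∈ t :: l, Derives S Γ (.tm u A)) →
      Derives S Γ (.tm (tuple (nu (app (orc o) t)) (l.map fun u => nu (app (orc o) u)))
        (bigConj (B.inst t) (l.map fun u => B.inst u)))
  -- conversion rules
  | convCon {Γ : Ctx} {φ : Con} {Φ Ψ : Kind} : Conv Φ Ψ →
      Derives S Γ (.con φ Φ) → Derives S Γ (.kind Ψ) → Derives S Γ (.con φ Ψ)
  | convTm {Γ : Ctx} {t s : Tm} {C D : Con} : Conv C D → Conv t s →
      Derives S Γ (.tm t C) → Derives S Γ (.con D star) → Derives S Γ (.tm s D)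

/-- `t : A`, that is, `Γ ⊢ t : A` for some `Γ`. -/
def HasType (S : OracleSig) (t : Tm) (A : Con) : Prop := ∃ Γ, Derives S Γ (.tm t A)

/-- `φ : Φ`, that is, `Γ ⊢ φ : Φ` for some `Γ`. -/
def HasKind (S : OracleSig) (φ : Con) (Φ : Kind) : Prop := ∃ Γ, Derives S Γ (.con φ Φ)

/-! ## Term contexts and oracular functions -/

/-- Term contexts `𝒞[ ]₁⋯[ ]ₙ`: terms with `n` distinct designated free variables, each of which
occurs exactly once. -/
structure TmContext where
  n : ℕ
  body : Tm
  hole : Fin n → ℕ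
  hole_injective : Function.Injective hole
  once : ∀ i, body.count (.tv (hole i)) = 1

open Classical in
/-- `𝒞[u₁]₁⋯[uₙ]ₙ`. -/
noncomputable def TmContext.fill (C : TmContext) (u : Fin C.n → Tm) : Tm :=
  C.body.fsubst fun x => if h : ∃ i, C.hole i = x then u h.choose else fvar x

/-- The `i`-th hole of `C` is applied to the term `t`. -/
def TmContext.HoleAppliedTo (C : TmContext) (i : Fin C.n) (t : Tm) : Prop :=
  ∃ (E : Tm) (z : ℕ), 0 < E.count (.tv z) ∧ C.body = E.subst1 (app (fvar (C.hole i)) t) z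

/-- A function `f_o` for each oracle constant `o`. -/
abbrev OracleFuns : Type := ℕ → (C : TmContext) → Fin C.n → Tm

/-- A closed term of type `A` without oracle constants. -/
def IsOracleValue (S : OracleSig) (u : Tm) (A : Con) : Prop :=
  u.Closed ∧ u.OracleFree ∧ HasType S u A

/-- The functions `f_o` are oracular functions. For a `0`-ary constant of type `Σ A` the values of
`f_o` are closed terms of type `A` without oracle constants. For a `1`-ary constant of type
`∀ x : A. Σ B` they are closed terms without oracle constants, of type `B[t/x]` where `t` is the
argument of the hole in question; if the hole has no argument, or one with variables bound by the
context, or if no closed term without oracle constants has type `B[t/x]` (for instance because `B[t/x]` is not a well-formed type), then the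
value may have any instance `B[t'/x]` of `B` as its type. -/
def OracleFuns.Oracular (S : OracleSig) (f : OracleFuns) : Prop :=
  ∀ (o : ℕ) (C : TmContext) (i : Fin C.n),
    match S o with
    | .nullary A => IsOracleValue S (f o C i) A
    | .unary _ B =>
        (∃ t' : Tm, IsOracleValue S (f o C i) (B.inst t')) ∧
        ∀ t : Tm, C.HoleAppliedTo i t → (∃ u, IsOracleValue S u (B.inst t)) →
          IsOracleValue S (f o C i) (B.inst t)

/-! ## Evaluation -/

namespace Expr

/-- Replacement of the subexpressions `(y t)ν` by `z` whenever `h y = some z`. -/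
def strip {s : Srt} {n : ℕ} (h : ℕ → Option ℕ) : Expr s n → Expr s n
  | nu (app (fvar y) t) =>
      match h y with
      | some z => fvar z
      | none => nu (app (fvar y) (t.strip h))
  | bvar i => bvar i
  | fvar x => fvar x
  | orc o => orc o
  | lam A t => lam (A.strip h) (t.strip h)
  | app t s => app (t.strip h) (s.strip h)
  | choice p t s => choice p (t.strip h) (s.strip h)
  | nu t => nu (t.strip h)
  | pair t s => pair (t.strip h) (s.strip h)
  | proj j t => proj j (t.strip h)
  | efq t => efq (t.strip h)
  | comp p k => comp p (k.strip h)
  | comps p t K s => comps p (t.strip h) (K.strip h) (s.strip h)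
  | cvar α => cvar α
  | bot => bot
  | clam A φ => clam (A.strip h) (φ.strip h)
  | capp φ t => capp (φ.strip h) (t.strip h)
  | all A φ => all (A.strip h) (φ.strip h)
  | plus φ => plus (φ.strip h)
  | sig φ => sig (φ.strip h)
  | conj φ ψ => conj (φ.strip h) (ψ.strip h)
  | star => star
  | pi A Φ => pi (A.strip h) (Φ.strip h)
  | nil => nil
  | cons t k => cons (t.strip h) (k.strip h)
  | nils => nils
  | conss k K => conss (k.strip h) (K.strip h)

end Expr

open Classical in
/-- `𝒟 = 𝒞[([ ]₁ t₁)ν]₁⋯[([ ]ₙ tₙ)ν]ₙ` for some terms `t₁, …, tₙ`, which may contain variables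
bound by `𝒞` at the respective hole; `e` matches the holes. As the hole variables `zᵢ` of `𝒞` do
not occur in `𝒟` but occur (exactly once) in `𝒞`, the equation forces each hole variable `yᵢ` of
`𝒟` to stand at the head of a subexpression `(yᵢ tᵢ)ν`, and none of these to lie inside another. -/
def AppliedHoles (C D : TmContext) (e : Fin D.n ≃ Fin C.n) : Prop :=
  (∀ i, D.body.count (.tv (C.hole i)) = 0) ∧
    C.body = D.body.strip fun y =>
      if h : ∃ i, D.hole i = y then some (C.hole (e h.choose)) else none

/-- `t ↦_p t'`. -/
inductive Eval (S : OracleSig) (f : OracleFuns) : ℚ → Tm → Tm → Prop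
  | beta (A : Con) (t : Expr .tm 1) (s : Tm) : Eval S f 1 (app (lam A t) s) (t.inst s)
  | proj₀ (t₀ t₁ : Tm) : Eval S f 1 (proj 0 (pair t₀ t₁)) t₀
  | proj₁ (t₀ t₁ : Tm) : Eval S f 1 (proj 1 (pair t₀ t₁)) t₁
  | choiceL (p : Prob) (t s : Tm) : Eval S f p (nu (choice p t s)) t
  | choiceR (p : Prob) (t s : Tm) : Eval S f (1 - p) (nu (choice p t s)) s
  /-- `𝒞[oν]₁⋯[oν]ₙ ↦₁ 𝒞[s₁]₁⋯[sₙ]ₙ` with `sᵢ = f_o(𝒞[ ]₁⋯[ ]ₙ, i)` and `n ≥ 1`. -/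
  | orc₀ (o : ℕ) (A : Con) (C : TmContext) : S o = .nullary A → 0 < C.n →
      Eval S f 1 (C.fill fun _ => nu (orc o)) (C.fill fun i => f o C i)
  /-- `𝒞[(o t₁)ν]₁⋯[(o tₙ)ν]ₙ = 𝒟[o]₁⋯[o]ₙ ↦₁ 𝒞[s₁]₁⋯[sₙ]ₙ` with `sᵢ = f_o(𝒟[ ]₁⋯[ ]ₙ, i)`
  and `n ≥ 1`. -/
  | orc₁ (o : ℕ) (A : Con) (B : Expr .con 1) (C D : TmContext) (e : Fin D.n ≃ Fin C.n) :
      S o = .unary A B → 0 < C.n → AppliedHoles C D e →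
      Eval S f 1 (D.fill fun _ => orc o) (C.fill fun i => f o D (e.symm i))
  /-- Evaluation at any depth: `s[t/x] ↦_p s[t'/x]` if `x` is a subterm of `s`. -/
  | ctx {p : ℚ} {t t' : Tm} (s : Tm) (x : ℕ) : s.HasSubtermVar x → Eval S f p t t' →
      Eval S f p (s.subst1 t x) (s.subst1 t' x)
  /-- Evaluation in the scope of a binder: `λ x : A. t ↦_p λ x : A. t'`. -/
  | lam {p : ℚ} {t t' : Tm} (A : Con) (x : ℕ) : Eval S f p t t' →
      Eval S f p (lam A (t.close x)) (lam A (t'.close x))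

/-! ## Strong normalisation -/

/-- There is no infinite sequence `t ↦_{p₁} t₁ ↦_{p₂} t₂ ↦_{p₃} ⋯`. -/
def Tm.StronglyNormalising (S : OracleSig) (f : OracleFuns) (t : Tm) : Prop :=
  ¬ ∃ (u : ℕ → Tm) (p : ℕ → ℚ), u 0 = t ∧ ∀ i, Eval S f (p i) (u i) (u (i + 1))

/-- There is no infinite sequence `φ ↦ φ₁ ↦ φ₂ ↦ ⋯`. -/
def Con.StronglyNormalising (φ : Con) : Prop :=
  ¬ ∃ u : ℕ → Con, u 0 = φ ∧ ∀ i, ConStep (u i) (u (i + 1))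

end OracleCalculus

namespace OracleCalculus

open _root_.OracleCalculus.Expr Relation

/-! For type constructors, a redex always substitutes a term, and a term is never a constructor
abstraction. Contraction can therefore expose a new redex at the head only through arguments that
are already waiting, as in `(λx.λy.φ) t s`, and otherwise merely copies redexes inside its argument.
A size computed with a stack of the sizes of the waiting arguments anticipates both effects and
drops at every step (`ConStep.size_lt`).

For terms, annotations are erased (`erase`) and dependent types collapse to simple types (`ty`), so
that conversion becomes invisible. On erased terms an oracle is a nondeterministic constant that may
return any admissible closed oracle-free term. All instances `B[t/x]` have the simple type of `B`,
so it does not matter which instance types the answer. Tait reducibility (`Ty.Red`) then yields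
strong normalisation of erased typable terms. There is an apparent circle: oracles are reducible if
their values are, and values are reducible by the fundamental lemma. It is broken because values
contain no oracles: `Derives.red` is relative to a set of oracle constants assumed reducible, and is
used with the empty set for the values and then with all constants.

Back to evaluation (`Eval.simulation`): β, projection and choice steps take place at genuine
subterms and so survive erasure as at least one step. An oracle step may act in annotations only and
leave the erasure unchanged, but it lowers the number of oracle constants, annotations included.
Ordering lexicographically by reduction of the erasure and then by this number excludes infinite
evaluations. -/

/-! ## Termination of constructor reduction -/

namespace Expr

/-- The environment `ρ` with the value `a` for a new innermost bound variable. -/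
def push {n : ℕ} (a : ℕ) (ρ : Fin n → ℕ) : Fin (n + 1) → ℕ := Fin.cases a ρ

/-- A size of expressions that decreases under constructor reduction. The sizes of the terms to
which a constructor is applied are kept on a stack, and `ρ` assigns sizes to the bound
variables. -/
def size {s : Srt} {n : ℕ} : Expr s n → (Fin n → ℕ) → List ℕ → ℕ
  | bvar i, ρ, l => ρ i + l.sum
  | fvar _, _, l => l.sum
  | orc _, _, l => l.sum
  | lam A t, ρ, l => A.size ρ [] + t.size (push 0 ρ) [] + l.sum
  | app t s, ρ, l => t.size ρ [] + s.size ρ [] + l.sum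
  | choice _ t s, ρ, l => t.size ρ [] + s.size ρ [] + l.sum
  | nu t, ρ, l => t.size ρ [] + l.sum
  | pair t s, ρ, l => t.size ρ [] + s.size ρ [] + l.sum
  | proj _ t, ρ, l => t.size ρ [] + l.sum
  | efq t, ρ, l => t.size ρ [] + l.sum
  | comp _ k, ρ, l => k.size ρ [] + l.sum
  | comps _ t K s, ρ, l => t.size ρ [] + K.size ρ [] + s.size ρ [] + l.sum
  | cvar _, _, l => l.sum
  | bot, _, l => l.sum
  | clam A φ, ρ, [] => A.size ρ [] + φ.size (push 0 ρ) []
  | clam A φ, ρ, a :: l => A.size ρ [] + φ.size (push a ρ) l + a + 1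
  | capp φ t, ρ, l => φ.size ρ (t.size ρ [] :: l)
  | all A φ, ρ, l => A.size ρ [] + φ.size (push 0 ρ) [] + l.sum
  | plus φ, ρ, l => φ.size ρ [] + l.sum
  | sig φ, ρ, l => φ.size ρ [] + l.sum
  | conj φ ψ, ρ, l => φ.size ρ [] + ψ.size ρ [] + l.sum
  | star, _, l => l.sum
  | pi A Φ, ρ, l => A.size ρ [] + Φ.size (push 0 ρ) [] + l.sum
  | nil, _, l => l.sum
  | cons t k, ρ, l => t.size ρ [] + k.size ρ [] + l.sum
  | nils, _, l => l.sum
  | conss k K, ρ, l => k.size ρ [] + K.size ρ [] + l.sum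

/-- Only constructor abstractions consume the stack, and no term is one. This is why a bound
variable can be represented by a single number in the environment. -/
theorem size_tm {n : ℕ} (t : Expr .tm n) (ρ : Fin n → ℕ) (l : List ℕ) :
    t.size ρ l = t.size ρ [] + l.sum := by
  cases t <;> simp [size]

theorem push_le {n : ℕ} {ρ ρ' : Fin n → ℕ} {a a' : ℕ} (ha : a ≤ a') (h : ∀ i, ρ i ≤ ρ' i)
    (i : Fin (n + 1)) :
    push a ρ i ≤ push a' ρ' i := by
  cases i using Fin.cases with
  | zero => exact ha
  | succ i => exact h i

/-- The size grows at least as fast as the sum of the stack. Plain monotonicity would not do: a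
reduction inside an argument must lower the size even if the argument is discarded, which is what
the summand `a` in the `clam` clause of `size` secures. -/
theorem size_mono {s : Srt} {n : ℕ} (e : Expr s n) {ρ ρ' : Fin n → ℕ} (h : ∀ i, ρ i ≤ ρ' i)
    {l l' : List ℕ} (hl : List.Forall₂ (· ≤ ·) l l') :
    e.size ρ l + l'.sum ≤ e.size ρ' l' + l.sum := by
  induction e generalizing l l' with
  | clam A φ ihA ih =>
    have hA := ihA h .nil
    cases hl with
    | nil =>
      have := ih (push_le (le_refl 0) h) .nil
      simp only [size, List.sum_nil] at *
      omega
    | cons ha hl =>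
      have := ih (push_le ha h) hl
      simp only [size, List.sum_cons, List.sum_nil] at *
      omega
  | capp φ t ihφ iht =>
    have ht := iht h .nil
    have := ihφ h (.cons (by simpa using ht) hl)
    simp only [size, List.sum_cons, List.sum_nil] at *
    omega
  | bvar i => have := h i; simp only [size]; omega
  | lam A t ihA ih | all A t ihA ih | pi A t ihA ih =>
    have hA := ihA h .nil
    have := ih (push_le (le_refl 0) h) .nil
    simp only [size, List.sum_nil] at *
    omega
  | nu t ih | proj _ t ih | efq t ih | comp _ t ih | plus t ih | sig t ih =>
    have := ih h .nil
    simp only [size, List.sum_nil] at *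
    omega
  | app t s ih₁ ih₂ | choice _ t s ih₁ ih₂ | pair t s ih₁ ih₂ | conj t s ih₁ ih₂
  | cons t s ih₁ ih₂ | conss t s ih₁ ih₂ =>
    have := ih₁ h .nil
    have := ih₂ h .nil
    simp only [size, List.sum_nil] at *
    omega
  | comps _ t K s ih₁ ih₂ ih₃ =>
    have := ih₁ h .nil
    have := ih₂ h .nil
    have := ih₃ h .nil
    simp only [size, List.sum_nil] at *
    omega
  | _ => simp only [size]; omega

theorem push_liftRen {n m : ℕ} (r : Fin n → Fin m) (ρ : Fin m → ℕ) (a : ℕ) :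
    (fun i => push a ρ (liftRen r i)) = push a (fun i => ρ (r i)) := by
  funext i
  cases i using Fin.cases <;> rfl

theorem size_rename {s : Srt} {n m : ℕ} (e : Expr s n) (r : Fin n → Fin m) (ρ : Fin m → ℕ)
    (l : List ℕ) : (e.rename r).size ρ l = e.size (fun i => ρ (r i)) l := by
  induction e generalizing m l with
  | clam A φ ihA ih => cases l <;> simp only [rename, size, ihA, ih, push_liftRen]
  | _ => simp_all only [rename, size, push_liftRen]

theorem liftF_fvar {n : ℕ} : liftF (fvar : ℕ → Expr .tm n) = fvar := rfl

theorem size_liftB {n m : ℕ} (b : Fin n → Expr .tm m) (ρ : Fin m → ℕ) (a : ℕ) :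
    (fun i => (liftB b i).size (push a ρ) []) = push a (fun i => (b i).size ρ []) := by
  funext i
  cases i using Fin.cases with
  | zero => simp [liftB, size, push]
  | succ i => simp [liftB, size_rename, push]

theorem size_subst {s : Srt} {n m : ℕ} (e : Expr s n) (b : Fin n → Expr .tm m) (ρ : Fin m → ℕ)
    (l : List ℕ) : (e.subst b fvar).size ρ l = e.size (fun i => (b i).size ρ []) l := by
  induction e generalizing m l with
  | bvar i => rw [subst, size_tm, size]
  | clam A φ ihA ih => cases l <;> simp only [subst, size, ihA, ih, liftF_fvar, size_liftB]
  | _ => simp_all only [subst, size, liftF_fvar, size_liftB]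

theorem size_inst {s : Srt} {n : ℕ} (e : Expr s (n + 1)) (u : Expr .tm n) (ρ : Fin n → ℕ)
    (l : List ℕ) : (e.inst u).size ρ l = e.size (push (u.size ρ []) ρ) l := by
  rw [inst, size_subst]
  congr 1
  funext i
  cases i using Fin.cases <;> simp [size, push]

end Expr

theorem ConStep.size_lt {s : Srt} {n : ℕ} {e e' : Expr s n} (h : ConStep e e') (ρ : Fin n → ℕ)
    (l : List ℕ) : e'.size ρ l < e.size ρ l := by
  induction h generalizing l with
  -- The redex exceeds its contractum by the sizes of annotation and argument plus `1`, the last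
  -- summand making the drop strict.
  | beta A φ t => rw [size_inst]; simp only [size]; omega
  | clam₁ _ ih => cases l <;> simp only [size] <;> grind
  | clam₂ _ ih => cases l <;> simp only [size] <;> grind
  | capp₁ _ ih => simp only [size, ih]
  | capp₂ _ ih =>
    rename_i φ t t' _
    have h1 := ih ρ []
    -- The stack entry of the argument drops, and `size_mono` passes the strict drop on to the
    -- whole.
    have := φ.size_mono (fun i => le_refl (ρ i))
      (.cons h1.le (List.forall₂_refl l) : List.Forall₂ (· ≤ ·) (t'.size ρ [] :: l) _)
    simp only [size, List.sum_cons] at *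
    omega
  | _ => simp only [size]; grind

theorem Con.stronglyNormalising (φ : Con) : φ.StronglyNormalising := by
  rintro ⟨u, -, hu⟩
  exact (RelEmbedding.natGT (fun i => (u i).size Fin.elim0 [])
    fun i => (hu i).size_lt _ _).not_wellFounded (r := (· < ·)) wellFounded_lt

/-! ## Terms without type annotations -/

/-- Terms without type annotations. All variables are de Bruijn indices. The constant `unit`
stands for what is erased. -/
inductive Raw : Type
  | unit
  | var (k : ℕ)
  | orc (o : ℕ)
  | lam (t : Raw)
  | app (t s : Raw)
  | choice (t s : Raw)
  | nu (t : Raw)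
  | pair (t s : Raw)
  | proj (j : Fin 2) (t : Raw)
  | efq (t : Raw)

namespace Raw

def upRen (r : ℕ → ℕ) : ℕ → ℕ
  | 0 => 0
  | k + 1 => r k + 1

def rename (r : ℕ → ℕ) : Raw → Raw
  | unit => unit
  | var k => var (r k)
  | orc o => orc o
  | lam t => lam (t.rename (upRen r))
  | app t s => app (t.rename r) (s.rename r)
  | choice t s => choice (t.rename r) (s.rename r)
  | nu t => nu (t.rename r)
  | pair t s => pair (t.rename r) (s.rename r)
  | proj j t => proj j (t.rename r)
  | efq t => efq (t.rename r)

def up (σ : ℕ → Raw) : ℕ → Raw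
  | 0 => var 0
  | k + 1 => (σ k).rename Nat.succ

def subst (σ : ℕ → Raw) : Raw → Raw
  | unit => unit
  | var k => σ k
  | orc o => orc o
  | lam t => lam (t.subst (up σ))
  | app t s => app (t.subst σ) (s.subst σ)
  | choice t s => choice (t.subst σ) (s.subst σ)
  | nu t => nu (t.subst σ)
  | pair t s => pair (t.subst σ) (s.subst σ)
  | proj j t => proj j (t.subst σ)
  | efq t => efq (t.subst σ)

/-- The substitution of `u` for the index `0` and of `σ k` for the index `k + 1`. -/
def scons (u : Raw) (σ : ℕ → Raw) : ℕ → Raw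
  | 0 => u
  | k + 1 => σ k

/-! ### Substitution calculus for erased terms -/

theorem up_var_comp (r : ℕ → ℕ) : up (fun k => var (r k)) = fun k => var (upRen r k) := by
  funext k; cases k <;> rfl

theorem rename_eq_subst (r : ℕ → ℕ) (t : Raw) : t.rename r = t.subst fun k => var (r k) := by
  induction t generalizing r <;> simp_all [rename, subst, up_var_comp]

theorem up_var : up var = var := by
  funext k; cases k <;> rfl

theorem subst_var (t : Raw) : t.subst var = t := by
  induction t <;> simp_all [subst, up_var]

theorem up_comp_upRen (r : ℕ → ℕ) (σ : ℕ → Raw) :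
    (fun k => up σ (upRen r k)) = up fun k => σ (r k) := by
  funext k; cases k <;> rfl

theorem subst_rename (r : ℕ → ℕ) (σ : ℕ → Raw) (t : Raw) :
    (t.rename r).subst σ = t.subst fun k => σ (r k) := by
  induction t generalizing r σ <;> simp_all [rename, subst, up_comp_upRen]

theorem rename_comp_up (r : ℕ → ℕ) (σ : ℕ → Raw) :
    (fun k => (up σ k).rename (upRen r)) = up fun k => (σ k).rename r := by
  funext k
  cases k with
  | zero => rfl
  | succ k =>
    simp only [up]
    rw [rename_eq_subst (upRen r), subst_rename, rename_eq_subst Nat.succ, rename_eq_subst r,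
      ← rename_eq_subst r, subst_rename]
    rfl

theorem rename_subst (r : ℕ → ℕ) (σ : ℕ → Raw) (t : Raw) :
    (t.subst σ).rename r = t.subst fun k => (σ k).rename r := by
  induction t generalizing r σ <;> simp_all [rename, subst, rename_comp_up]

theorem subst_comp_up (σ τ : ℕ → Raw) :
    (fun k => (up σ k).subst (up τ)) = up fun k => (σ k).subst τ := by
  funext k
  cases k with
  | zero => rfl
  | succ k => simp only [up, subst_rename, rename_subst]

theorem subst_subst (σ τ : ℕ → Raw) (t : Raw) :
    (t.subst σ).subst τ = t.subst fun k => (σ k).subst τ := by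
  induction t generalizing σ τ <;> simp_all [subst, subst_comp_up]

theorem subst_up_scons (σ : ℕ → Raw) (u : Raw) (t : Raw) :
    (t.subst (up σ)).subst (scons u var) = t.subst (scons u σ) := by
  rw [subst_subst]
  congr 1
  funext k
  cases k with
  | zero => rfl
  | succ k => rw [up, subst_rename]; exact subst_var _

theorem subst_scons_subst (σ : ℕ → Raw) (u : Raw) (t : Raw) :
    (t.subst (scons u var)).subst σ = (t.subst (up σ)).subst (scons (u.subst σ) var) := by
  rw [subst_up_scons, subst_subst]
  congr 1
  funext k
  cases k <;> rfl

/-- All oracle constants of the term satisfy `P`. -/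
def OrcsIn (P : ℕ → Prop) : Raw → Prop
  | unit => True
  | var _ => True
  | orc o => P o
  | lam t => t.OrcsIn P
  | app t s => t.OrcsIn P ∧ s.OrcsIn P
  | choice t s => t.OrcsIn P ∧ s.OrcsIn P
  | nu t => t.OrcsIn P
  | pair t s => t.OrcsIn P ∧ s.OrcsIn P
  | proj _ t => t.OrcsIn P
  | efq t => t.OrcsIn P

theorem orcsIn_true (t : Raw) : t.OrcsIn fun _ => True := by
  induction t <;> simp_all [OrcsIn]

end Raw

/-- The values that oracle constants may return, at `o ν` and at `(o t) ν` respectively. -/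
structure Values where
  nullary : ℕ → Raw → Prop
  unary : ℕ → Raw → Prop
  subst_nullary : ∀ {o v}, nullary o v → ∀ σ, v.subst σ = v
  subst_unary : ∀ {o v}, unary o v → ∀ σ, v.subst σ = v

open Raw in
/-- One-step reduction of terms without annotations, where oracle constants return any of their
values. -/
inductive Raw.Step (V : Values) : Raw → Raw → Prop
  | beta (t s : Raw) : Step V (app (lam t) s) (t.subst (scons s var))
  | proj₀ (t s : Raw) : Step V (proj 0 (pair t s)) t
  | proj₁ (t s : Raw) : Step V (proj 1 (pair t s)) s
  | choiceL (t s : Raw) : Step V (nu (choice t s)) t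
  | choiceR (t s : Raw) : Step V (nu (choice t s)) s
  | orc₀ {o : ℕ} {v : Raw} : V.nullary o v → Step V (nu (orc o)) v
  | orc₁ {o : ℕ} {v : Raw} (t : Raw) : V.unary o v → Step V (nu (app (orc o) t)) v
  | lam {t t' : Raw} : Step V t t' → Step V (lam t) (lam t')
  | app_left {t t' s : Raw} : Step V t t' → Step V (app t s) (app t' s)
  | app_right {t s s' : Raw} : Step V s s' → Step V (app t s) (app t s')
  | choice_left {t t' s : Raw} : Step V t t' → Step V (choice t s) (choice t' s)
  | choice_right {t s s' : Raw} : Step V s s' → Step V (choice t s) (choice t s')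
  | nu {t t' : Raw} : Step V t t' → Step V (nu t) (nu t')
  | pair_left {t t' s : Raw} : Step V t t' → Step V (pair t s) (pair t' s)
  | pair_right {t s s' : Raw} : Step V s s' → Step V (pair t s) (pair t s')
  | proj {j : Fin 2} {t t' : Raw} : Step V t t' → Step V (proj j t) (proj j t')
  | efq {t t' : Raw} : Step V t t' → Step V (efq t) (efq t')

namespace Raw

variable {V : Values}

/-- Oracle steps are stable because values are invariant under substitution and, in the unary case,
are not tied to the argument. -/
theorem Step.subst {t t' : Raw} (h : Step V t t') (σ : ℕ → Raw) :
    Step V (t.subst σ) (t'.subst σ) := by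
  induction h generalizing σ with
  | beta t s => rw [subst_scons_subst]; exact .beta _ _
  | orc₀ hv => rw [V.subst_nullary hv]; exact .orc₀ hv
  | orc₁ t hv => rw [V.subst_unary hv]; exact .orc₁ _ hv
  | proj₀ t s => exact .proj₀ _ _
  | proj₁ t s => exact .proj₁ _ _
  | choiceL t s => exact .choiceL _ _
  | choiceR t s => exact .choiceR _ _
  | lam _ ih => exact .lam (ih _)
  | app_left _ ih => exact .app_left (ih _)
  | app_right _ ih => exact .app_right (ih _)
  | choice_left _ ih => exact .choice_left (ih _)
  | choice_right _ ih => exact .choice_right (ih _)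
  | nu _ ih => exact .nu (ih _)
  | pair_left _ ih => exact .pair_left (ih _)
  | pair_right _ ih => exact .pair_right (ih _)
  | proj _ ih => exact .proj (ih _)
  | efq _ ih => exact .efq (ih _)

/-! ## Reducibility -/

/-- Strong normalisation. -/
def SN (V : Values) (t : Raw) : Prop := Acc (fun a b => Step V b a) t

/-- The map `g` would carry an infinite reduction of `t` to one of `g t`. -/
theorem SN.of_map {g : Raw → Raw} (hg : ∀ {a b}, Step V a b → Step V (g a) (g b)) {t : Raw}
    (h : SN V (g t)) : SN V t :=
  Subrelation.accessible (fun h => hg h) (InvImage.accessible g h)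

/-- Terms that can be put in head position without giving rise to a redex there. -/
def Neutral : Raw → Prop
  | lam _ => False
  | pair _ _ => False
  | choice _ _ => False
  | orc _ => False
  | app (orc _) _ => False
  | _ => True

theorem Neutral.app {t : Raw} (h : t.Neutral) (s : Raw) : (app t s).Neutral := by
  cases t <;> simp_all [Neutral]

end Raw

/-- Simple types. -/
inductive Ty : Type
  | base
  | arr (A B : Ty)
  | prod (A B : Ty)
  | box (A : Ty)

open Raw in
/-- Reducible terms of a simple type. -/
def Ty.Red (V : Values) : Ty → Raw → Prop
  | base => SN V
  | arr A B => fun t => ∀ s, A.Red V s → B.Red V (app t s)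
  | prod A B => fun t => A.Red V (proj 0 t) ∧ B.Red V (proj 1 t)
  | box A => fun t => A.Red V (nu t)

namespace Ty

open Raw

variable {V : Values}

theorem Red.step {A : Ty} {t t' : Raw} (h : A.Red V t) (ht : Step V t t') : A.Red V t' := by
  induction A generalizing t t' with
  | base => exact Acc.inv h ht
  | arr A B _ ih => exact fun s hs => ih (h s hs) (.app_left ht)
  | prod A B ih₁ ih₂ => exact ⟨ih₁ h.1 (.proj ht), ih₂ h.2 (.proj ht)⟩
  | box A ih => exact ih h (.nu ht)

/-- Girard's conditions CR1 and CR3 must be proved together: CR1 at an arrow type applies the term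
to a variable, which is reducible by CR3 at the domain, having no reducts. For CR3, an elimination
applied to a neutral term is no redex, so it reduces only inside its parts. -/
theorem red_sn_and_neutral (A : Ty) :
    (∀ t, A.Red V t → SN V t) ∧
      ∀ t : Raw, t.Neutral → (∀ t', Step V t t' → A.Red V t') → A.Red V t := by
  induction A with
  | base => exact ⟨fun t h => h, fun t _ h => Acc.intro t h⟩
  | arr A B ihA ihB =>
    refine ⟨fun t h => ?_, fun t hn h s hs => ?_⟩
    · have h0 : A.Red V (var 0) := ihA.2 _ trivial fun t' ht' => nomatch ht'
      exact SN.of_map (g := fun t => app t (var 0)) .app_left (ihB.1 _ (h _ h0))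
    · have hsn := ihA.1 s hs
      induction hsn with
      | intro s _ ih =>
        refine ihB.2 _ (hn.app s) fun u hu => ?_
        cases hu with
        | beta => exact hn.elim
        | app_left ht => exact h _ ht s hs
        | app_right hs' => exact ih _ hs' (hs.step hs')
  | prod A B ihA ihB =>
    refine ⟨fun t h => SN.of_map (g := Raw.proj 0) .proj (ihA.1 _ h.1), fun t hn h => ⟨?_, ?_⟩⟩
    · refine ihA.2 _ trivial fun u hu => ?_
      cases hu with
      | proj₀ => exact hn.elim
      | proj ht => exact (h _ ht).1
    · refine ihB.2 _ trivial fun u hu => ?_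
      cases hu with
      | proj₁ => exact hn.elim
      | proj ht => exact (h _ ht).2
  | box A ih =>
    refine ⟨fun t h => SN.of_map (g := Raw.nu) .nu (ih.1 _ h), fun t hn h => ?_⟩
    refine ih.2 _ trivial fun u hu => ?_
    cases hu with
    | choiceL | choiceR | orc₀ | orc₁ => exact hn.elim
    | nu ht => exact h _ ht

theorem Red.sn {A : Ty} {t : Raw} (h : A.Red V t) : SN V t := A.red_sn_and_neutral.1 t h

theorem Red.of_neutral {A : Ty} {t : Raw} (hn : t.Neutral)
    (h : ∀ t', Step V t t' → A.Red V t') : A.Red V t :=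
  A.red_sn_and_neutral.2 t hn h

theorem red_var (A : Ty) (k : ℕ) : A.Red V (var k) :=
  .of_neutral trivial fun _ h => nomatch h

/-- The application to `s` is neutral, so its one-step reducts suffice: the contractum is covered by
the hypothesis, the others by nested induction on strong normalisation of `t` and `s`. That `t` is
strongly normalising follows by substituting a variable. -/
theorem red_lam {A B : Ty} {t : Raw}
    (h : ∀ s, A.Red V s → B.Red V (t.subst (scons s var))) : (arr A B).Red V (lam t) := by
  have ht : SN V t :=
    SN.of_map (g := Raw.subst (scons (var 0) var)) (fun h => h.subst _) (h _ (red_var A 0)).sn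
  induction ht with
  | intro t _ iht =>
    intro s hs
    have hsn := hs.sn
    induction hsn with
    | intro s _ ihs =>
      refine .of_neutral trivial fun u hu => ?_
      cases hu with
      | beta => exact h s hs
      | app_left ht =>
        cases ht with
        | lam ht => exact iht _ ht (fun s hs => (h s hs).step (ht.subst _)) s hs
      | app_right hs' => exact ihs _ hs' (hs.step hs')

theorem red_pair {A B : Ty} {t s : Raw} (ht : A.Red V t) (hs : B.Red V s) :
    (prod A B).Red V (pair t s) := by
  have htn := ht.sn
  induction htn generalizing s with
  | intro t _ iht =>
    have hsn := hs.sn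
    induction hsn with
    | intro s _ ihs =>
      constructor <;> refine .of_neutral trivial fun u hu => ?_
      · cases hu with
        | proj₀ => exact ht
        | proj hu =>
          cases hu with
          | pair_left h => exact (iht _ h (ht.step h) hs).1
          | pair_right h => exact (ihs _ h (hs.step h)).1
      · cases hu with
        | proj₁ => exact hs
        | proj hu =>
          cases hu with
          | pair_left h => exact (iht _ h (ht.step h) hs).2
          | pair_right h => exact (ihs _ h (hs.step h)).2

theorem red_choice {A : Ty} {t s : Raw} (ht : A.Red V t) (hs : A.Red V s) :
    (box A).Red V (choice t s) := by
  have htn := ht.sn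
  induction htn generalizing s with
  | intro t _ iht =>
    have hsn := hs.sn
    induction hsn with
    | intro s _ ihs =>
      refine .of_neutral (t := Raw.nu _) trivial fun u hu => ?_
      cases hu with
      | choiceL => exact ht
      | choiceR => exact hs
      | nu hu =>
        cases hu with
        | choice_left h => exact iht _ h (ht.step h) hs
        | choice_right h => exact ihs _ h (hs.step h)

/-- No reduction rule fires at `efq`, which is neutral, so it is reducible at every type. -/
theorem red_efq {A : Ty} {t : Raw} (ht : SN V t) : A.Red V (efq t) := by
  induction ht with
  | intro t _ ih =>
    refine .of_neutral trivial fun u hu => ?_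
    cases hu with
    | efq h => exact ih _ h

theorem red_orc_nullary {A : Ty} {o : ℕ} (h : ∀ v, V.nullary o v → A.Red V v) :
    (box A).Red V (orc o) := by
  refine .of_neutral (t := Raw.nu _) trivial fun u hu => ?_
  cases hu with
  | orc₀ hv => exact h _ hv
  | nu hu => nomatch hu

/-- After application and `nu`, either the oracle answers with a reducible value or the argument
reduces; the latter is handled by induction on its strong normalisation. -/
theorem red_orc_unary {A B : Ty} {o : ℕ} (h : ∀ v, V.unary o v → B.Red V v) :
    (arr A (box B)).Red V (orc o) := by
  intro s hs
  have hsn := hs.sn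
  induction hsn with
  | intro s _ ih =>
    refine .of_neutral (t := Raw.nu _) trivial fun u hu => ?_
    cases hu with
    | orc₁ _ hv => exact h _ hv
    | nu hu =>
      cases hu with
      | app_left hu => nomatch hu
      | app_right hu => exact ih _ hu (hs.step hu)

end Ty

/-! ## Erasure of type annotations -/

namespace Expr

/-- Erasure of type annotations. The free variable `x` becomes the index `n + x`, and lists of
terms become nested pairs. -/
def erase {s : Srt} {n : ℕ} : Expr s n → Raw
  | bvar i => .var i
  | @fvar n x => .var (n + x)
  | orc o => .orc o
  | lam _ t => .lam t.erase
  | app t s => .app t.erase s.erase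
  | choice _ t s => .choice t.erase s.erase
  | nu t => .nu t.erase
  | pair t s => .pair t.erase s.erase
  | proj j t => .proj j t.erase
  | efq t => .efq t.erase
  | comp _ k => k.erase
  | comps _ t K s => .pair t.erase (.pair K.erase s.erase)
  | cons t k => .pair t.erase k.erase
  | conss k K => .pair k.erase K.erase
  | _ => .unit

/-- The simple type underlying a type constructor. -/
def ty {s : Srt} {n : ℕ} : Expr s n → Ty
  | clam _ φ => φ.ty
  | capp φ _ => φ.ty
  | all A φ => .arr A.ty φ.ty
  | plus φ => .box φ.ty
  | sig φ => .box φ.ty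
  | conj φ ψ => .prod φ.ty ψ.ty
  | _ => .base

end Expr

namespace Raw

/-- The map `b` on the indices below `n`, and `f`, shifted by `n`, on the others. -/
def glue {α : Type} {n : ℕ} (b : Fin n → α) (f : ℕ → α) (k : ℕ) : α :=
  if h : k < n then b ⟨k, h⟩ else f (k - n)

theorem glue_fin {α : Type} {n : ℕ} (b : Fin n → α) (f : ℕ → α) (i : Fin n) :
    glue b f i = b i := by
  simp [glue]

theorem glue_add {α : Type} {n : ℕ} (b : Fin n → α) (f : ℕ → α) (x : ℕ) :
    glue b f (n + x) = f x := by
  simp [glue]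

theorem glue_zero {α : Type} (b : Fin 0 → α) (f : ℕ → α) : glue b f = f := by
  funext k; simp [glue]

end Raw

namespace Expr

open Raw (up upRen glue glue_fin glue_add glue_zero)

theorem upRen_glue {n m : ℕ} (r : Fin n → Fin m) :
    upRen (glue (fun i => (r i : ℕ)) (m + ·)) =
      glue (fun i => (liftRen r i : ℕ)) (m + 1 + ·) := by
  funext k
  cases k with
  | zero => rfl
  | succ k =>
    by_cases h : k < n
    · simp only [upRen, glue, h, Nat.succ_lt_succ h, dite_true]
      rfl
    · simp only [upRen, glue, h, dite_false, Nat.succ_lt_succ_iff]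
      omega

theorem erase_rename {s : Srt} {n m : ℕ} (e : Expr s n) (r : Fin n → Fin m) :
    (e.rename r).erase = e.erase.rename (glue (fun i => (r i : ℕ)) (m + ·)) := by
  induction e generalizing m with
  | bvar i => simp only [rename, erase, Raw.rename, glue_fin]
  | fvar x => simp only [rename, erase, Raw.rename, glue_add]
  | _ => simp_all only [rename, erase, Raw.rename, upRen_glue]

theorem erase_rename_succ {s : Srt} {n : ℕ} (e : Expr s n) :
    (e.rename Fin.succ).erase = e.erase.rename Nat.succ := by
  rw [erase_rename]
  congr 1
  funext k
  by_cases h : k < n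
  · simp [glue, h]
  · simp only [glue, h, dite_false]
    omega

theorem up_glue {n m : ℕ} (b : Fin n → Expr .tm m) (f : ℕ → Expr .tm m) :
    up (glue (fun i => (b i).erase) fun x => (f x).erase) =
      glue (fun i => (liftB b i).erase) fun x => (liftF f x).erase := by
  funext k
  cases k with
  | zero => rfl
  | succ k =>
    by_cases h : k < n
    · simp only [up, glue, h, Nat.succ_lt_succ h, dite_true]
      exact (erase_rename_succ _).symm
    · simp only [up, glue, h, dite_false, Nat.succ_lt_succ_iff, liftF, erase_rename_succ,
        Nat.add_sub_add_right]

theorem erase_subst {s : Srt} {n m : ℕ} (e : Expr s n) (b : Fin n → Expr .tm m)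
    (f : ℕ → Expr .tm m) :
    (e.subst b f).erase =
      e.erase.subst (glue (fun i => (b i).erase) fun x => (f x).erase) := by
  induction e generalizing m with
  | bvar i => simp only [subst, erase, Raw.subst, glue_fin]
  | fvar x => simp only [subst, erase, Raw.subst, glue_add]
  | _ => simp_all only [subst, erase, Raw.subst, up_glue]

theorem erase_fsubst {s : Srt} (e : Expr s 0) (f : ℕ → Tm) :
    (e.fsubst f).erase = e.erase.subst fun x => (f x).erase := by
  rw [fsubst, erase_subst, glue_zero]

theorem erase_close {s : Srt} (e : Expr s 0) (x : ℕ) :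
    (e.close x).erase = e.erase.rename fun y => if y = x then 0 else y + 1 := by
  rw [close, erase_subst, glue_zero, Raw.rename_eq_subst]
  congr 1
  funext y
  split <;> simp [erase, Nat.add_comm]

theorem erase_inst {s : Srt} (e : Expr s 1) (u : Tm) :
    (e.inst u).erase = e.erase.subst (Raw.scons u.erase Raw.var) := by
  rw [inst, erase_subst]
  congr 1
  funext k
  cases k with
  | zero => rfl
  | succ k => simp [glue, erase, Raw.scons]

theorem erase_subst_of_closed {s : Srt} {n : ℕ} {e : Expr s n} (he : e.Closed) {σ : ℕ → Raw}
    (hσ : ∀ k < n, σ k = .var k) : e.erase.subst σ = e.erase := by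
  induction e generalizing σ with
  | bvar i => exact hσ _ i.isLt
  | fvar x => simpa [count] using he x
  | lam A t _ ih =>
    rw [erase, Raw.subst, ih]
    · exact fun x => by have := he x; simp only [count] at this; omega
    · rintro (_ | k) hk
      · rfl
      · rw [up, hσ k (by omega)]
        rfl
  | _ => simp_all [erase, Raw.subst, Closed, count, forall_and]

theorem orcsIn_erase_of_oracleFree {s : Srt} {n : ℕ} {e : Expr s n} (he : e.OracleFree)
    (P : ℕ → Prop) : e.erase.OrcsIn P := by
  induction e with
  | orc o => simpa [count] using he o
  | _ => simp_all [erase, Raw.OrcsIn, OracleFree, count, forall_and]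

/-- Simple types ignore the terms on which a type depends. Hence all instances of an oracle's result
type share one notion of reducibility. -/
theorem ty_subst {s : Srt} {n m : ℕ} (e : Expr s n) (b : Fin n → Expr .tm m)
    (f : ℕ → Expr .tm m) (hs : s ≠ .tm) : (e.subst b f).ty = e.ty := by
  induction e generalizing m <;> simp_all [subst, ty]

end Expr

/-- Inside a term, constructor redexes occur only in annotations, which are erased. -/
theorem ConStep.erase_ty {s : Srt} {n : ℕ} {e e' : Expr s n} (h : ConStep e e') :
    e'.erase = e.erase ∧ (s = .con → e'.ty = e.ty) := by
  induction h with
  | beta A φ t => exact ⟨by cases φ <;> rfl, fun _ => ty_subst _ _ _ (by simp)⟩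
  | _ => simp_all [erase, ty]

theorem Conv.erase_eq {s : Srt} {n : ℕ} {e e' : Expr s n} (h : Conv e e') :
    e'.erase = e.erase := by
  have key {a b : Expr s n} (h : ReflTransGen ConStep a b) : b.erase = a.erase := by
    induction h with
    | refl => rfl
    | tail _ h ih => exact h.erase_ty.1.trans ih
  exact h.elim key fun h => (key h).symm

theorem Conv.ty_eq {n : ℕ} {A B : Expr .con n} (h : Conv A B) : B.ty = A.ty := by
  have key {a b : Expr .con n} (h : ReflTransGen ConStep a b) : b.ty = a.ty := by
    induction h with
    | refl => rfl
    | tail _ h ih => exact (h.erase_ty.2 rfl).trans ih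
  exact h.elim key fun h => (key h).symm

/-! ## Counting oracle constants -/

namespace Expr

/-- The number of oracle constants of an expression, type annotations included, where each free
variable `x` counts `w x` times. -/
def weight {s : Srt} {n : ℕ} (w : ℕ → ℕ) : Expr s n → ℕ
  | bvar _ => 0
  | fvar x => w x
  | orc _ => 1
  | lam A t => A.weight w + t.weight w
  | app t s => t.weight w + s.weight w
  | choice _ t s => t.weight w + s.weight w
  | nu t => t.weight w
  | pair t s => t.weight w + s.weight w
  | proj _ t => t.weight w
  | efq t => t.weight w
  | comp _ k => k.weight w
  | comps _ t K s => t.weight w + K.weight w + s.weight w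
  | cvar _ => 0
  | bot => 0
  | clam A φ => A.weight w + φ.weight w
  | capp φ t => φ.weight w + t.weight w
  | all A φ => A.weight w + φ.weight w
  | plus φ => φ.weight w
  | sig φ => φ.weight w
  | conj φ ψ => φ.weight w + ψ.weight w
  | star => 0
  | pi A Φ => A.weight w + Φ.weight w
  | nil => 0
  | cons t k => t.weight w + k.weight w
  | nils => 0
  | conss k K => k.weight w + K.weight w

theorem weight_rename {s : Srt} {n m : ℕ} (w : ℕ → ℕ) (e : Expr s n) (r : Fin n → Fin m) :
    (e.rename r).weight w = e.weight w := by
  induction e generalizing m <;> simp_all only [rename, weight]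

theorem weight_liftB {n m : ℕ} {w : ℕ → ℕ} {b : Fin n → Expr .tm m}
    (hb : ∀ i, (b i).weight w = 0) (i : Fin (n + 1)) : (liftB b i).weight w = 0 := by
  cases i using Fin.cases with
  | zero => rfl
  | succ i => exact (weight_rename _ _ _).trans (hb i)

theorem weight_liftF {m : ℕ} (w : ℕ → ℕ) (f : ℕ → Expr .tm m) (x : ℕ) :
    (liftF f x).weight w = (f x).weight w :=
  weight_rename _ _ _

theorem weight_subst {s : Srt} {n m : ℕ} (w : ℕ → ℕ) (e : Expr s n) {b : Fin n → Expr .tm m}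
    (hb : ∀ i, (b i).weight w = 0) (f : ℕ → Expr .tm m) :
    (e.subst b f).weight w = e.weight fun x => (f x).weight w := by
  induction e generalizing m with
  | bvar i => exact hb i
  | lam A t ihA ih | clam A t ihA ih | all A t ihA ih | pi A t ihA ih =>
    simp only [subst, weight, ihA hb, ih (weight_liftB hb), weight_liftF]
  | _ => simp_all only [subst, weight, implies_true]

theorem weight_fsubst {s : Srt} (w : ℕ → ℕ) (e : Expr s 0) (f : ℕ → Tm) :
    (e.fsubst f).weight w = e.weight fun x => (f x).weight w :=
  weight_subst w e (fun i => i.elim0) f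

theorem weight_close {s : Srt} (e : Expr s 0) (x : ℕ) :
    (e.close x).weight (fun _ => 0) = e.weight fun _ => 0 := by
  rw [close, weight_subst _ _ fun i => i.elim0]
  congr 1
  funext y
  split <;> rfl

/-- Each occurrence of `x`, even in an annotation, contributes at least `1` to the difference. -/
theorem weight_lt {s : Srt} {n : ℕ} {w w' : ℕ → ℕ} (h : ∀ x, w x ≤ w' x) {e : Expr s n} {x : ℕ}
    (hx : w x < w' x) (he : 0 < e.count (.tv x)) : e.weight w < e.weight w' := by
  have key : e.weight w + e.count (.tv x) ≤ e.weight w' := by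
    clear he
    induction e with
    | fvar y =>
      have := h y
      simp only [weight, count]
      split
      · simp_all
      · omega
    | _ => simp only [weight, count, reduceCtorEq, if_false]; omega
  omega

theorem weight_eq_zero {s : Srt} {n : ℕ} {e : Expr s n} (h : e.Closed) (h' : e.OracleFree)
    (w : ℕ → ℕ) : e.weight w = 0 := by
  induction e with
  | fvar x => simpa [count] using h x
  | orc o => simpa [count] using h' o
  | _ => simp_all only [weight, Closed, OracleFree, count, forall_and, Nat.add_eq_zero_iff,
    implies_true]

theorem count_pos_of_hasSubtermVar {s : Srt} {n : ℕ} {e : Expr s n} {x : ℕ}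
    (h : e.HasSubtermVar x) : 0 < e.count (.tv x) := by
  induction e with
  | fvar y => cases h; simp [count]
  | bvar | orc | nil | nils | cvar | bot | clam | capp | all | plus | sig | conj | star | pi =>
    exact h.elim
  | _ => simp only [HasSubtermVar] at h; simp only [count]; grind

theorem strip_nu {n : ℕ} (h : ℕ → Option ℕ) (t : Expr .tm n) :
    (∃ y t' z, t = app (fvar y) t' ∧ h y = some z ∧ (nu t).strip h = fvar z) ∨
      (nu t).strip h = nu (t.strip h) := by
  cases t with
  | app t s =>
    cases t with
    | fvar y =>
      cases hy : h y with
      | some z => exact .inl ⟨y, s, z, rfl, hy, by simp [strip, hy]⟩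
      | none => exact .inr (by simp [strip, hy])
    | _ => exact .inr (by simp [strip])
  | _ => exact .inr (by simp [strip])

theorem weight_strip_le {s : Srt} {n : ℕ} (h : ℕ → Option ℕ) (e : Expr s n) :
    (e.strip h).weight (fun _ => 0) ≤ e.weight fun _ => 0 := by
  induction e with
  | nu t ih =>
    obtain ⟨y, t', z, rfl, -, hs⟩ | hs := strip_nu h t
    · rw [hs]
      exact Nat.zero_le _
    · rwa [hs, weight, weight]
  | _ => simp only [weight, strip]; omega

/-- Every new `z` replaces a subterm headed by `y`, so it is paid for by an occurrence of `y`;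
replacements by other variables only remove occurrences. -/
theorem count_strip_le {s : Srt} {n : ℕ} {h : ℕ → Option ℕ} {y z : ℕ} (hy : ∀ x, h x ≠ some y)
    (hz : ∀ x, h x = some z → x = y) (e : Expr s n) :
    (e.strip h).count (.tv y) + (e.strip h).count (.tv z) ≤
      e.count (.tv y) + e.count (.tv z) := by
  induction e with
  | nu t ih =>
    obtain ⟨x, t', z', rfl, hx, hs⟩ | hs := strip_nu h t
    · rw [hs]
      have h1 : z' ≠ y := by
        rintro rfl
        exact hy _ hx
      by_cases h2 : z' = z
      · subst h2
        obtain rfl := hz _ hx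
        simp [count, h1.symm]
        omega
      · simp [count, h1.symm, Ne.symm h2]
    · rwa [hs, count, count, count, count]
  | _ => simp only [count, strip] at *; omega

end Expr

/-! ## Simulation of evaluation -/

namespace Raw

variable {V : Values}

theorem reflTransGen_map₂ (g : Raw → Raw → Raw)
    (hl : ∀ {t t' s}, Step V t t' → Step V (g t s) (g t' s))
    (hr : ∀ {t s s'}, Step V s s' → Step V (g t s) (g t s')) {t t' s s' : Raw}
    (ht : ReflTransGen (Step V) t t') (hs : ReflTransGen (Step V) s s') :
    ReflTransGen (Step V) (g t s) (g t' s') :=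
  (ht.lift (g · s) fun _ _ => hl).trans (hs.lift (g t') fun _ _ => hr)

theorem transGen_map₂_left (g : Raw → Raw → Raw)
    (hl : ∀ {t t' s}, Step V t t' → Step V (g t s) (g t' s))
    (hr : ∀ {t s s'}, Step V s s' → Step V (g t s) (g t s')) {t t' s s' : Raw}
    (ht : TransGen (Step V) t t') (hs : ReflTransGen (Step V) s s') :
    TransGen (Step V) (g t s) (g t' s') :=
  (ht.lift (g · s) fun _ _ => hl).trans_left (hs.lift (g t') fun _ _ => hr)

theorem transGen_map₂_right (g : Raw → Raw → Raw)
    (hl : ∀ {t t' s}, Step V t t' → Step V (g t s) (g t' s))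
    (hr : ∀ {t s s'}, Step V s s' → Step V (g t s) (g t s')) {t t' s s' : Raw}
    (ht : ReflTransGen (Step V) t t') (hs : TransGen (Step V) s s') :
    TransGen (Step V) (g t s) (g t' s') :=
  TransGen.trans_right (ht.lift (g · s) fun _ _ => hl) (hs.lift (g t') fun _ _ => hr)

theorem Step.rename {t t' : Raw} (h : Step V t t') (r : ℕ → ℕ) :
    Step V (t.rename r) (t'.rename r) := by
  rw [rename_eq_subst, rename_eq_subst]
  exact h.subst _

theorem reflTransGen_up {σ σ' : ℕ → Raw} (h : ∀ k, ReflTransGen (Step V) (σ k) (σ' k)) (k : ℕ) :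
    ReflTransGen (Step V) (up σ k) (up σ' k) := by
  cases k with
  | zero => exact .refl
  | succ k => exact (h k).lift _ fun _ _ h => h.rename _

theorem reflTransGen_subst {σ σ' : ℕ → Raw} (h : ∀ k, ReflTransGen (Step V) (σ k) (σ' k))
    (t : Raw) : ReflTransGen (Step V) (t.subst σ) (t.subst σ') := by
  induction t generalizing σ σ' with
  | unit | orc => exact .refl
  | var k => exact h k
  | lam t ih => exact (ih (reflTransGen_up h)).lift _ fun _ _ => .lam
  | app t s iht ihs => exact reflTransGen_map₂ Raw.app .app_left .app_right (iht h) (ihs h)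
  | choice t s iht ihs => exact reflTransGen_map₂ Raw.choice .choice_left .choice_right (iht h) (ihs h)
  | nu t ih => exact (ih h).lift _ fun _ _ => .nu
  | pair t s iht ihs => exact reflTransGen_map₂ Raw.pair .pair_left .pair_right (iht h) (ihs h)
  | proj j t ih => exact (ih h).lift _ fun _ _ => .proj
  | efq t ih => exact (ih h).lift _ fun _ _ => .efq

end Raw

namespace Expr

open Raw (Step reflTransGen_map₂ transGen_map₂_left transGen_map₂_right reflTransGen_subst
  reflTransGen_up up)

variable {V : Values}

/-- A variable that is a subterm, and not merely mentioned in an annotation, survives erasure, so at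
least one step is really performed. -/
theorem transGen_erase_subst {s : Srt} {n : ℕ} {e : Expr s n} {x : ℕ} (hx : e.HasSubtermVar x)
    {σ σ' : ℕ → Raw} (h : ∀ k, ReflTransGen (Step V) (σ k) (σ' k))
    (h' : TransGen (Step V) (σ (n + x)) (σ' (n + x))) :
    TransGen (Step V) (e.erase.subst σ) (e.erase.subst σ') := by
  have hr {s : Srt} {n : ℕ} (e : Expr s n) := reflTransGen_subst h e.erase
  induction e generalizing σ σ' with
  | fvar y => cases hx; exact h'
  | lam A t _ ih =>
    refine (ih hx (reflTransGen_up h) ?_ fun e => reflTransGen_subst (reflTransGen_up h) _).lift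
      _ fun _ _ => .lam
    rw [Nat.add_right_comm]
    exact h'.lift _ fun _ _ h => h.rename _
  | app t s iht ihs =>
    exact hx.elim (fun hx => transGen_map₂_left Raw.app .app_left .app_right (iht hx h h' hr) (hr _))
      fun hx => transGen_map₂_right Raw.app .app_left .app_right (hr _) (ihs hx h h' hr)
  | choice p t s iht ihs =>
    exact hx.elim
      (fun hx => transGen_map₂_left Raw.choice .choice_left .choice_right (iht hx h h' hr) (hr _))
      fun hx => transGen_map₂_right Raw.choice .choice_left .choice_right (hr _) (ihs hx h h' hr)
  | pair t s iht ihs | cons t s iht ihs | conss t s iht ihs =>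
    exact hx.elim
      (fun hx => transGen_map₂_left Raw.pair .pair_left .pair_right (iht hx h h' hr) (hr _))
      fun hx => transGen_map₂_right Raw.pair .pair_left .pair_right (hr _) (ihs hx h h' hr)
  | comps p t K s iht ihK ihs =>
    have hKs := reflTransGen_map₂ Raw.pair .pair_left .pair_right (hr K) (hr s)
    obtain hx | hx | hx := hx
    · exact transGen_map₂_left Raw.pair .pair_left .pair_right (iht hx h h' hr) hKs
    · exact transGen_map₂_right Raw.pair .pair_left .pair_right (hr _)
        (transGen_map₂_left Raw.pair .pair_left .pair_right (ihK hx h h' hr) (hr _))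
    · exact transGen_map₂_right Raw.pair .pair_left .pair_right (hr _)
        (transGen_map₂_right Raw.pair .pair_left .pair_right (hr _) (ihs hx h h' hr))
  | nu t ih => exact (ih hx h h' hr).lift _ fun _ _ => .nu
  | proj j t ih => exact (ih hx h h' hr).lift _ fun _ _ => .proj
  | efq t ih => exact (ih hx h h' hr).lift _ fun _ _ => .efq
  | comp p k ih => exact ih hx h h' hr
  | _ => exact hx.elim

/-- Oracle constants, substituted for the variables `y` of the subterms `(y t)ν` that are
stripped, may return the values that are substituted for the variables introduced by
stripping. -/
theorem reflTransGen_strip {s : Srt} {n : ℕ} {h : ℕ → Option ℕ} (e : Expr s n)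
    {σ σ' : ℕ → Raw}
    (hv : ∀ y z, h y = some z → ∃ o, σ (n + y) = .orc o ∧ V.unary o (σ' (n + z)))
    (hb : ∀ k < n, σ k = σ' k)
    (hf : ∀ x, 0 < e.count (.tv x) → 0 < (e.strip h).count (.tv x) → σ (n + x) = σ' (n + x)) :
    ReflTransGen (Step V) (e.erase.subst σ) ((e.strip h).erase.subst σ') := by
  induction e generalizing σ σ' with
  | bvar i =>
    simp only [erase, strip, Raw.subst, hb i i.isLt]
    exact .refl
  | fvar x =>
    simp only [erase, strip, Raw.subst, hf x (by simp [count]) (by simp [count, strip])]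
    exact .refl
  | lam A t _ ih =>
    refine (ih (fun y z hy => ?_) (fun k hk => ?_) (fun x h1 h2 => ?_)).lift _ fun _ _ => .lam
    · obtain ⟨o, ho, hz⟩ := hv y z hy
      refine ⟨o, ?_, ?_⟩
      · rw [Nat.add_right_comm, up, ho]
        rfl
      -- Values are closed, so the shift under the binder leaves them unchanged.
      · rw [Nat.add_right_comm, up, Raw.rename_eq_subst, V.subst_unary hz]
        exact hz
    · cases k with
      | zero => rfl
      | succ k => simp only [up, hb k (by omega)]
    · rw [Nat.add_right_comm, up, up, hf x]
      · simp only [count]; omega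
      · simp only [count, strip]; omega
  | nu t ih =>
    obtain ⟨y, t', z, rfl, hy, hs⟩ | hs := strip_nu h t
    · obtain ⟨o, ho, hz⟩ := hv y z hy
      simp only [hs, erase, Raw.subst, ho]
      -- The argument `t'` vanishes with the oracle call, so nothing inside it has to be simulated.
      exact .single (.orc₁ _ hz)
    · rw [hs] at hf ⊢
      exact (ih hv hb hf).lift _ fun _ _ => .nu
  | proj j t ih => exact (ih hv hb hf).lift _ fun _ _ => .proj
  | efq t ih => exact (ih hv hb hf).lift _ fun _ _ => .efq
  | comp p k ih => exact ih hv hb hf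
  | app t s iht ihs =>
    simp only [count, strip] at hf
    exact reflTransGen_map₂ Raw.app .app_left .app_right
      (iht hv hb fun x _ _ => hf x (by omega) (by omega))
      (ihs hv hb fun x _ _ => hf x (by omega) (by omega))
  | choice p t s iht ihs =>
    simp only [count, strip] at hf
    exact reflTransGen_map₂ Raw.choice .choice_left .choice_right
      (iht hv hb fun x _ _ => hf x (by omega) (by omega))
      (ihs hv hb fun x _ _ => hf x (by omega) (by omega))
  | pair t s iht ihs | cons t s iht ihs | conss t s iht ihs =>
    simp only [count, strip] at hf
    exact reflTransGen_map₂ Raw.pair .pair_left .pair_right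
      (iht hv hb fun x _ _ => hf x (by omega) (by omega))
      (ihs hv hb fun x _ _ => hf x (by omega) (by omega))
  | comps p t K s iht ihK ihs =>
    simp only [count, strip] at hf
    exact reflTransGen_map₂ Raw.pair .pair_left .pair_right
      (iht hv hb fun x _ _ => hf x (by omega) (by omega))
      (reflTransGen_map₂ Raw.pair .pair_left .pair_right
        (ihK hv hb fun x _ _ => hf x (by omega) (by omega))
        (ihs hv hb fun x _ _ => hf x (by omega) (by omega)))
  | _ => exact .refl

end Expr

/-! ### Filling of term contexts, oracle values and simulation -/

open Classical in
/-- The substitution of `u i` for the `i`-th hole. -/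
noncomputable def TmContext.assign (C : TmContext) (u : Fin C.n → Tm) (x : ℕ) : Tm :=
  if h : ∃ i, C.hole i = x then u h.choose else fvar x

theorem TmContext.fill_eq (C : TmContext) (u : Fin C.n → Tm) :
    C.fill u = C.body.fsubst (C.assign u) := rfl

theorem TmContext.assign_hole (C : TmContext) (u : Fin C.n → Tm) (i : Fin C.n) :
    C.assign u (C.hole i) = u i := by
  have h : ∃ j, C.hole j = C.hole i := ⟨i, rfl⟩
  rw [assign, dif_pos h, C.hole_injective h.choose_spec]

theorem TmContext.assign_of_ne (C : TmContext) (u : Fin C.n → Tm) {x : ℕ}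
    (h : ∀ i, C.hole i ≠ x) : C.assign u x = fvar x := by
  rw [assign, dif_neg fun ⟨i, hi⟩ => h i hi]

/-- The values of a system of oracular functions: erasures of closed terms, without oracle
constants, of the types required. -/
def OracleSig.values (S : OracleSig) : Values where
  nullary o v := ∃ A u, S o = .nullary A ∧ IsOracleValue S u A ∧ u.erase = v
  unary o v := ∃ A B t u, S o = .unary A B ∧ IsOracleValue S u (B.inst t) ∧ u.erase = v
  subst_nullary := by
    rintro o _ ⟨A, u, -, hu, rfl⟩ σ
    exact erase_subst_of_closed hu.1 (by simp)
  subst_unary := by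
    rintro o _ ⟨A, B, t, u, -, hu, rfl⟩ σ
    exact erase_subst_of_closed hu.1 (by simp)

/-- In `D` the hole variable and its counterpart in `C` occur once and not at all. Stripping does
not increase the sum of the two counts, and the counterpart occurs once in `C`, so nothing is left
for the hole variable of `D`. -/
theorem AppliedHoles.count_eq_zero {C D : TmContext} {e : Fin D.n ≃ Fin C.n}
    (h : AppliedHoles C D e) (i : Fin D.n) : C.body.count (.tv (D.hole i)) = 0 := by
  classical
  have hD (j : Fin D.n) (k : Fin C.n) : D.hole j ≠ C.hole k := fun hjk => by
    have := D.once j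
    rw [hjk, h.1 k] at this
    omega
  have hle := count_strip_le (y := D.hole i) (z := C.hole (e i)) (e := D.body)
    (h := fun y => if h : ∃ i, D.hole i = y then some (C.hole (e h.choose)) else none)
    (fun x hx => ?_) (fun x hx => ?_)
  · rw [← h.2, C.once, D.once, h.1] at hle
    omega
  · split at hx
    · exact hD _ _ (Option.some.inj hx).symm
    · cases hx
  · split at hx
    · rename_i hx'
      rw [← hx'.choose_spec, e.injective (C.hole_injective (Option.some.inj hx))]
    · cases hx

theorem OracleFuns.Oracular.nullary {S : OracleSig} {f : OracleFuns} (hf : f.Oracular S) {o : ℕ}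
    {A : Con} (ho : S o = .nullary A) (C : TmContext) (i : Fin C.n) :
    IsOracleValue S (f o C i) A := by
  have := hf o C i
  rwa [ho] at this

theorem OracleFuns.Oracular.unary {S : OracleSig} {f : OracleFuns} (hf : f.Oracular S) {o : ℕ}
    {A : Con} {B : Expr .con 1} (ho : S o = .unary A B) (C : TmContext) (i : Fin C.n) :
    ∃ t, IsOracleValue S (f o C i) (B.inst t) := by
  have := hf o C i
  rw [ho] at this
  exact this.1

theorem weight_assign_le {C : TmContext} {u u' : Fin C.n → Tm} {w : ℕ → ℕ}
    (h : ∀ i, (u i).weight w ≤ (u' i).weight w) (x : ℕ) :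
    (C.assign u x).weight w ≤ (C.assign u' x).weight w := by
  by_cases hx : ∃ i, C.hole i = x
  · obtain ⟨i, rfl⟩ := hx
    simpa only [C.assign_hole] using h i
  · push Not at hx
    rw [C.assign_of_ne _ hx, C.assign_of_ne _ hx]

theorem weight_fill_lt {C : TmContext} (hC : 0 < C.n) {u u' : Fin C.n → Tm} {w : ℕ → ℕ}
    (h : ∀ i, (u i).weight w < (u' i).weight w) : (C.fill u).weight w < (C.fill u').weight w := by
  rw [C.fill_eq, C.fill_eq, weight_fsubst, weight_fsubst]
  refine weight_lt (weight_assign_le fun i => (h i).le) (x := C.hole ⟨0, hC⟩) ?_ ?_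
  · simpa only [C.assign_hole] using h _
  · rw [C.once]
    exact one_pos

/-- An evaluation step reduces the erased term, or it takes place within annotations, reducing the
number of oracle constants. -/
theorem Eval.simulation {S : OracleSig} {f : OracleFuns} (hf : f.Oracular S) {p : ℚ} {t t' : Tm}
    (h : Eval S f p t t') :
    TransGen (Raw.Step S.values) t.erase t'.erase ∨
      ReflTransGen (Raw.Step S.values) t.erase t'.erase ∧
        t'.weight (fun _ => 0) < t.weight fun _ => 0 := by
  induction h with
  | beta A t s =>
    rw [erase_inst]
    exact .inl (.single (.beta _ _))
  | proj₀ => exact .inl (.single (.proj₀ _ _))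
  | proj₁ => exact .inl (.single (.proj₁ _ _))
  | choiceL => exact .inl (.single (.choiceL _ _))
  | choiceR => exact .inl (.single (.choiceR _ _))
  | orc₀ o A C ho hn =>
    have hv := hf.nullary ho C
    -- All holes may lie in annotations, so possibly no erased step occurs; but each filled hole
    -- weighs `1` before and `0` after the step.
    refine .inr ⟨?_, weight_fill_lt hn fun i => ?_⟩
    · rw [C.fill_eq, C.fill_eq, erase_fsubst, erase_fsubst]
      refine Raw.reflTransGen_subst (fun x => ?_) _
      by_cases hx : ∃ i, C.hole i = x
      · obtain ⟨i, rfl⟩ := hx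
        rw [C.assign_hole, C.assign_hole]
        exact .single (.orc₀ ⟨A, _, ho, hv i, rfl⟩)
      · push Not at hx
        rw [C.assign_of_ne _ hx, C.assign_of_ne _ hx]
    · rw [weight_eq_zero (hv i).1 (hv i).2.1]
      exact one_pos
  | orc₁ o A B C D e ho hn hCD =>
    have hv := hf.unary ho D
    refine .inr ⟨?_, ?_⟩
    · rw [C.fill_eq, D.fill_eq, erase_fsubst, erase_fsubst, hCD.2]
      refine reflTransGen_strip _ (fun y z hy => ?_) (fun k hk => by omega) fun x h1 h2 => ?_
      · split at hy
        · rename_i hy'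
          obtain rfl := Option.some.inj hy
          obtain ⟨t, ht⟩ := hv (e.symm (e hy'.choose))
          refine ⟨o, ?_, A, B, t, _, ho, ht, ?_⟩
          · rw [← hy'.choose_spec, Nat.zero_add, D.assign_hole]
            rfl
          · rw [Nat.zero_add, C.assign_hole]
        · cases hy
      -- A variable occurring in both bodies is a hole of neither context, so both assignments fix
      -- it.
      · rw [← hCD.2] at h2
        rw [Nat.zero_add, C.assign_of_ne, D.assign_of_ne]
        · rintro i rfl
          exact h2.ne' (hCD.count_eq_zero i)
        · rintro i rfl
          exact h1.ne' (hCD.1 i)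
    · have h0 (x : ℕ) : (C.assign (fun i => f o D (e.symm i)) x).weight (fun _ => 0) = 0 := by
        by_cases hx : ∃ i, C.hole i = x
        · obtain ⟨i, rfl⟩ := hx
          obtain ⟨t, ht⟩ := hv (e.symm i)
          rw [C.assign_hole, weight_eq_zero ht.1 ht.2.1]
        · push Not at hx
          rw [C.assign_of_ne _ hx]
          rfl
      -- The result weighs as much as the stripped body of `D` with variables counted `0`. Stripping
      -- adds no weight, and filling `D` with oracle constants adds some.
      rw [C.fill_eq, D.fill_eq, weight_fsubst, weight_fsubst, funext h0, hCD.2]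
      refine (weight_strip_le _ _).trans_lt ?_
      refine weight_lt (fun x => Nat.zero_le _) (x := D.hole (e.symm ⟨0, hn⟩)) ?_ ?_
      · rw [D.assign_hole]
        exact one_pos
      · rw [D.once]
        exact one_pos
  | @ctx p t t' s x hx _ ih =>
    rw [subst1, subst1, erase_fsubst, erase_fsubst, weight_fsubst, weight_fsubst]
    have hup (r : Raw → Raw → Prop) (hr : ∀ k, r (.var k) (.var k)) (h : r t.erase t'.erase)
        (y : ℕ) : r (Function.update fvar x t y : Tm).erase
          (Function.update fvar x t' y : Tm).erase := by
      by_cases hy : y = x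
      · simpa only [hy, Function.update_self] using h
      · simp only [Function.update_of_ne hy]
        exact hr _
    have hsteps := hup (ReflTransGen (Raw.Step S.values)) fun k => .refl
    obtain h | ⟨h, hw⟩ := ih
    · refine .inl (transGen_erase_subst hx (hsteps h.to_reflTransGen) ?_)
      simpa only [Nat.zero_add, Function.update_self] using h
    · refine .inr ⟨Raw.reflTransGen_subst (hsteps h) _,
        weight_lt (fun y => ?_) (x := x) ?_ (count_pos_of_hasSubtermVar hx)⟩
      · by_cases hy : y = x
        · simpa only [hy, Function.update_self] using hw.le
        · simp only [Function.update_of_ne hy, le_refl]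
      · simpa only [Function.update_self] using hw
  | lam A x _ ih =>
    simp only [erase, erase_close, weight, weight_close, Nat.add_lt_add_iff_left]
    have hl {a b : Raw} (h : Raw.Step S.values a b) :
        Raw.Step S.values (a.rename fun y => if y = x then 0 else y + 1).lam
          (b.rename fun y => if y = x then 0 else y + 1).lam := .lam (h.rename _)
    exact ih.imp (fun h => h.lift (fun a : Raw => (a.rename _).lam) fun _ _ => hl)
      (And.imp_left fun h => h.lift (fun a : Raw => (a.rename _).lam) fun _ _ => hl)

/-- This is the lexicographic argument: by induction on the erasure, an infinite evaluation would
have constant erasure, and then the number of oracle constants would decrease forever. -/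
theorem Tm.stronglyNormalising_of_sn {S : OracleSig} {f : OracleFuns} (hf : f.Oracular S) {t : Tm}
    (ht : t.erase.SN S.values) : t.StronglyNormalising S f := by
  rintro ⟨u, p, rfl, hu⟩
  replace ht := ht.transGen
  generalize hr : (u 0).erase = r at ht
  induction ht generalizing u p with
  | intro r _ ih =>
    -- If the erasure ever became a proper reduct of `r`, the tail from there would contradict the
    -- induction hypothesis.
    have ih {r' : Raw} (h : TransGen (Raw.Step S.values) r r') (k : ℕ) :
        (u k).erase ≠ r' := fun hk =>
      ih r' (transGen_swap.2 h) (fun i => u (k + i)) (fun i => p (k + i)) (fun i => hu _) hk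
    have key (k : ℕ) : (u k).erase = r ∧
        (u (k + 1)).weight (fun _ => 0) < (u k).weight fun _ => 0 := by
      induction k with
      | zero =>
        refine ⟨hr, ?_⟩
        obtain h | h := (hu 0).simulation hf
        · exact absurd rfl (ih (hr ▸ h) 1)
        · exact h.2
      | succ k ihk =>
        have hk : (u (k + 1)).erase = r := by
          obtain h | ⟨h, -⟩ := (hu k).simulation hf
          · exact absurd rfl (ih (ihk.1 ▸ h) _)
          · obtain h | h := reflTransGen_iff_eq_or_transGen.1 h
            · exact h.trans ihk.1
            · exact absurd rfl (ih (ihk.1 ▸ h) _)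
        refine ⟨hk, ?_⟩
        obtain h | h := (hu (k + 1)).simulation hf
        · exact absurd rfl (ih (hk ▸ h) _)
        · exact h.2
    exact (RelEmbedding.natGT (fun i => (u i).weight fun _ => 0)
      fun i => (key i).2).not_wellFounded (r := (· < ·)) wellFounded_lt

/-! ## Typable terms are reducible -/

theorem Raw.orcsIn_rename {P : ℕ → Prop} {t : Raw} {r : ℕ → ℕ} :
    (t.rename r).OrcsIn P ↔ t.OrcsIn P := by
  induction t generalizing r <;> simp_all [rename, OrcsIn]

/-- No declared term variable occurs in the context to the left of its declaration. -/
def Ctx.WellScoped (Γ : Ctx) : Prop :=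
  List.Pairwise (fun d d' => ∀ x A, d = .tm x A → ¬ d'.Mentions (.tv x)) Γ

/-- Needed for abstraction in `Derives.red`: redefining the substitution at the newest variable must
not disturb earlier declarations. -/
theorem Derives.wellScoped {S : OracleSig} {Γ : Ctx} {J : Judgement} (h : Derives S Γ J) :
    Ctx.WellScoped Γ := by
  induction h with
  | star | bot => exact .nil
  | cvar _ _ ih => exact .cons (fun d _ x A hx => nomatch hx) ih
  | weakenCon _ _ _ ih => exact .cons (fun d _ x A hx => nomatch hx) ih
  | fvar hx _ ih =>
    refine .cons (fun d hd y B hy => ?_) ih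
    cases hy
    exact hx d hd
  | weakenTm hx _ _ ih =>
    refine .cons (fun d hd y B hy => ?_) ih
    cases hy
    exact hx d hd
  | pi _ ih | all _ ih | clam _ ih | lam _ ih => exact List.Pairwise.of_cons ih
  | orcTuple₁ _ _ ih => exact ih
  | _ => assumption

/-- The oracle constant `o` is reducible at the simple type underlying its type. -/
def OracleType.Red (V : Values) (o : ℕ) : OracleType → Prop
  | .nullary A => (Ty.box A.ty).Red V (.orc o)
  | .unary A B => (Ty.arr A.ty (.box B.ty)).Red V (.orc o)

theorem orcsIn_of_mem_tuple {P : ℕ → Prop} {t : Tm} {l : List Tm}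
    (h : (tuple t l).erase.OrcsIn P) : ∀ u ∈ t :: l, u.erase.OrcsIn P := by
  induction l generalizing t with
  | nil => exact List.forall_mem_singleton.2 h
  | cons s l ih => exact List.forall_mem_cons.2 ⟨h.1, ih h.2⟩

theorem red_tuple {V : Values} {g : ℕ → Raw} {A : Ty} {α : Type*} {T : α → Tm} {C : α → Con}
    {a : α} {l : List α} (hC : ∀ a, (C a).ty = A)
    (h : ∀ b ∈ a :: l, A.Red V ((T b).erase.subst g)) :
    (bigConj (C a) (l.map C)).ty.Red V ((tuple (T a) (l.map T)).erase.subst g) := by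
  induction l generalizing a with
  | nil => simpa [bigConj, tuple, hC] using h
  | cons b l ih =>
    refine Ty.red_pair ?_ (ih fun c hc => h c (.tail _ hc))
    rw [hC]
    exact h a (.head _)

/-- The fundamental lemma of the reducibility method, by induction on derivations. The set `P` lets
it be applied to oracle-free terms before any oracle is known to be reducible. -/
theorem Derives.red {S : OracleSig} {V : Values} {P : ℕ → Prop}
    (hP : ∀ o, P o → (S o).Red V o) {Γ : Ctx} {J : Judgement} (h : Derives S Γ J) {t : Tm}
    {A : Con} (hJ : J = .tm t A) (ht : t.erase.OrcsIn P) {g : ℕ → Raw}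
    (hg : ∀ x B, Decl.tm x B ∈ Γ → B.ty.Red V (g x)) : A.ty.Red V (t.erase.subst g) := by
  induction h generalizing t A g with
  | cvar | star | bot | pi | all | plus | sig | conj | clam | capp | convCon => cases hJ
  | weakenCon _ _ _ _ ih | weakenTm _ _ _ _ ih =>
    exact ih hJ ht fun x B hx => hg x B (.tail _ hx)
  | @fvar Γ x A =>
    cases hJ
    have := hg x _ (.head _)
    rwa [erase, Raw.subst, Nat.zero_add]
  | @lam Γ x A B t h ih =>
    cases hJ
    refine Ty.red_lam fun s hs => ?_
    rw [erase_close, Raw.subst_rename, Raw.subst_subst, close, ty_subst _ _ _ (by simp)]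
    rw [erase, Raw.OrcsIn, erase_close, Raw.orcsIn_rename] at ht
    have h' := ih (g := fun y => if y = x then s else g y) rfl ht fun y C hy => ?_
    -- Closing `x`, lifting `g` and instantiating with `s` amount to sending `x` to `s` and any
    -- other `y` to `g y`.
    · convert h' using 2
      funext y
      by_cases hy : y = x
      · simp [hy, Raw.up, Raw.subst, Raw.scons]
      · simp only [hy, if_false, Raw.up, Raw.subst_rename]
        exact Raw.subst_var _
    · obtain hm | hm := List.mem_cons.1 hy
      · cases hm
        simpa using hs
      · rw [if_neg]
        · exact hg y C hm
        · rintro rfl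
          exact List.rel_of_pairwise_cons h.wellScoped hm _ _ rfl (Or.inl rfl)
  | app _ _ ih₁ ih₂ =>
    cases hJ
    rw [inst, ty_subst _ _ _ (by simp)]
    exact ih₁ rfl ht.1 hg _ (ih₂ rfl ht.2 hg)
  | efq _ _ _ ih =>
    cases hJ
    exact Ty.red_efq (ih rfl ht hg)
  | pair _ _ ih₁ ih₂ =>
    cases hJ
    exact Ty.red_pair (ih₁ rfl ht.1 hg) (ih₂ rfl ht.2 hg)
  | proj₀ _ ih =>
    cases hJ
    exact (ih rfl ht hg).1
  | proj₁ _ ih =>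
    cases hJ
    exact (ih rfl ht hg).2
  | choice _ _ ih₁ ih₂ =>
    cases hJ
    exact Ty.red_choice (ih₁ rfl ht.1 hg) (ih₂ rfl ht.2 hg)
  | nu _ ih | orcNu _ ih =>
    cases hJ
    exact ih rfl ht hg
  | @orc₀ Γ o A ho =>
    cases hJ
    have := hP o ht
    rwa [ho] at this
  | @orc₁ Γ o A B ho =>
    cases hJ
    have := hP o ht
    rwa [ho] at this
  | orcApp _ _ ih₁ ih₂ =>
    cases hJ
    rw [ty, inst, ty_subst _ _ _ (by simp)]
    exact ih₁ rfl ht.1 hg _ (ih₂ rfl ht.2 hg)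
  | @orcTuple₀ Γ o A A' k _ _ ih =>
    cases hJ
    -- The tuple repeats one entry, so the index type carries no information.
    have h := red_tuple (V := V) (g := g) (T := fun _ : Unit => Expr.nu (Expr.orc o))
      (C := fun _ => A) (a := ()) (l := List.replicate k ()) (fun _ => rfl)
      fun _ _ => ih rfl (orcsIn_of_mem_tuple ht _ (.head _)) hg
    simpa only [List.map_replicate] using h
  | @orcTuple₁ Γ o A B t l _ _ ih ihs =>
    cases hJ
    refine red_tuple (T := fun u => Expr.nu (Expr.app (Expr.orc o) u)) (C := fun u => B.inst u) (A := B.ty)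
      (fun u => ty_subst _ _ _ (by simp)) fun u hu => ?_
    have hu' := orcsIn_of_mem_tuple ht (Expr.nu (Expr.app (Expr.orc o) u)) (by
      rw [← List.map_cons (f := fun u => Expr.nu (Expr.app (Expr.orc o) u))]
      exact List.mem_map_of_mem hu)
    exact ih rfl hu'.1 hg _ (ihs u hu rfl hu'.2 hg)
  | convTm hC ht' _ _ ih =>
    cases hJ
    rw [hC.ty_eq, ht'.erase_eq] at *
    exact ih rfl ht hg

/-- The fundamental lemma is used twice: with no oracles allowed it makes the values reducible,
hence all oracle constants; with all oracles allowed it then covers `t`. Variables are reducible, so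
the identity substitution may be taken. -/
theorem HasType.sn {S : OracleSig} {t : Tm} {A : Con} (h : HasType S t A) :
    t.erase.SN S.values := by
  have hval {u : Tm} {A : Con} (hu : IsOracleValue S u A) : A.ty.Red S.values u.erase := by
    obtain ⟨-, hu, Γ, h⟩ := hu
    have := h.red (V := S.values) (P := fun _ => False) (fun _ h => h.elim) rfl
      (orcsIn_erase_of_oracleFree hu _) (g := Raw.var) fun x B _ => Ty.red_var _ _
    rwa [Raw.subst_var] at this
  have horc (o : ℕ) : (S o).Red S.values o := by
    cases ho : S o with
    | nullary A =>
      refine Ty.red_orc_nullary ?_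
      rintro _ ⟨A', u, ho', hu, rfl⟩
      cases ho.symm.trans ho'
      exact hval hu
    | unary A B =>
      refine Ty.red_orc_unary ?_
      rintro _ ⟨A', B', t, u, ho', hu, rfl⟩
      cases ho.symm.trans ho'
      have := hval hu
      -- The instance of `B'` that types the value is unknown, but its simple type is that of `B'`.
      rwa [inst, ty_subst _ _ _ (by simp)] at this
  obtain ⟨Γ, h⟩ := h
  have := h.red (fun o _ => horc o) rfl t.erase.orcsIn_true (g := Raw.var)
    fun x B _ => Ty.red_var _ _
  rw [Raw.subst_var] at this
  exact this.sn

end OracleCalculus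

theorem mainTheorem1 (S : OracleCalculus.OracleSig) (f : OracleCalculus.OracleFuns)
    (hf : OracleCalculus.OracleFuns.Oracular S f) :
    (∀ (A : OracleCalculus.Con) (t : OracleCalculus.Tm),
      OracleCalculus.HasType S t A → OracleCalculus.Tm.StronglyNormalising S f t) ∧
    (∀ (Φ : OracleCalculus.Kind) (φ : OracleCalculus.Con),
      OracleCalculus.HasKind S φ Φ → OracleCalculus.Con.StronglyNormalising φ) :=
  ⟨fun _ _ ht => OracleCalculus.Tm.stronglyNormalising_of_sn hf ht.sn,
    fun _ φ _ => φ.stronglyNormalising⟩
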